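/- Let $F$ be a field of characteristic zero. The fusion law $\mathcal J(\tfrac12)$ on $\{1,0,\tfrac12\}$ is $1*1=\{1\}$, $1*0=0*1=\emptyset$, $0*0=\{0\}$, $1*\tfrac12=\tfrac12*1=0*\tfrac12=\tfrac12*0=\{\tfrac12\}$, $\tfrac12*\tfrac12=\{1,0\}$. For a commutative non-associative $F$-algebra $A$, $a\in A$ and $\lambda \in F$, let $A_\lambda(a)=\{u\in A: au=\lambda u\}$. A primitive axis of $A$ is an idempotent $a\ne 0$ with $A=A_1(a)\oplus A_0(a)\oplus A_{1/2}(a)$, $A_\lambda(a)A_\mu(a)\subseteq\bigoplus_{\nu\in\lambda*\mu}A_\nu(a)$ for $\lambda,\mu\in\{1,0,\tfrac12\}$, and $A_1(a)=Fa$. Its Miyamoto involution $\tau_a$ is the automorphism of $A$ that is $1$ on $A_1(a)\oplus A_0(a)$ and $-1$ on $A_{1/2}(a)$. Let $A$ be an algebra of Jordan type half over $F$, that is, a commutative non-associative algebra generated by a set $X$ of primitive axes. Let $\mathrm{Miy}(A)=\langle\tau_a: a\in X\rangle$ and $\bar X=\{\varphi(a): a\in X,\ \varphi\in\mathrm{Miy}(A)\}$.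 A 3-transposition group is a pair $(G,D)$ in which $D$ is a conjugation-invariant set of elements of order $2$ generating the group $G$, with $cd$ of order at most $3$ for all $c,d\in D$. Its Matsuo algebra $M_{1/2}(G,D)$ over $F$ has basis $D$ and the product $c\cdot c=c$, $c\cdot d=0$ if $|cd|=2$, and $c\cdot d=\frac14(c+d-d^{-1}cd)$ if $|cd|=3$. Then either $A$ has infinitely many primitive axes, or $A$ is a Matsuo algebra $M_{1/2}(G,D)$ or a factor of one (that is, for some 3-transposition group $(G,D)$ there is a surjective algebra homomorphism $M_{1/2}(G,D)\to A$). Moreover, if $A$ has only finitely many primitive axes, then: 1. For any two distinct primitive axes $a,b$ of $A$, the subalgebra generated by $a$ and $b$ is either $2B=F\oplus F$, with $a=(1,0)$ and $b=(0,1)$, or $3C(\tfrac12)$, with basis $a$, $b$, $c=\tau_b(a)=\tau_a(b)$ consisting of idempotents, and the product of any two of them equal to $\frac14$ of their sum minus the third. 2. $\mathrm{Miy}(A)$ is a 3-transposition group with respect to $D=\{\tau_a: a\in\bar X,\ \tau_a\ne 1\}$. 3. There is an algebra homomorphism $M_{1/2}(\mathrm{Miy}(A),D)\to A$ that sends $\tau_a$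 to $a$ for every $a\in\bar X$ with $\tau_a\neq 1$; it is surjective if $\tau_a\ne1$ for all $a\in X$. -/

import Mathlib

universe u v

noncomputable section

/-! Commutative non-associative algebras over a field `F` are `NonUnitalNonAssocCommRing`s that
are `F`-modules with bilinear multiplication. -/

/-- A fusion law `(𝓕, *)` whose underlying set `𝓕` is a set of scalars. -/
structure FusionLaw (F : Type v) where
  /-- the underlying set of eigenvalues -/
  carrier : Set F
  /-- the set-valued operation; only its values on `carrier` matter -/
  star : F → F → Set F

/-- The Jordan type fusion law `𝓙(η)` on `{1, 0, η}`. -/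
def jordanLaw {F : Type v} [Field F] (η : F) : FusionLaw F where
  carrier := {1, 0, η}
  star := fun l m => {n |
    (l = 1 ∧ m = 1 ∧ n = 1) ∨
    (l = 0 ∧ m = 0 ∧ n = 0) ∨
    ((l = 1 ∨ l = 0) ∧ m = η ∧ n = η) ∨
    (l = η ∧ (m = 1 ∨ m = 0) ∧ n = η) ∨
    (l = η ∧ m = η ∧ (n = 1 ∨ n = 0))}

section Axes

set_option linter.unusedSectionVars false

variable {F : Type v} [Field F] {A : Type u} [NonUnitalNonAssocCommRing A] [Module F A]
  [IsScalarTower F A A] [SMulCommClass F A A]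

/-- The eigenspace `A_l(a) = {u | a * u = l • u}` of the adjoint map of `a`. -/
def axisEigenspace (a : A) (l : F) : Submodule F A :=
  Module.End.eigenspace (LinearMap.mulLeft F a) l

/-- `A_Λ(a)`, the sum of the eigenspaces `A_l(a)` with `l ∈ Λ`
(the sum is automatically direct). -/
def axisEigenspaceSet (a : A) (S : Set F) : Submodule F A :=
  ⨆ l ∈ S, axisEigenspace a l

/-- `a` is an axis for the fusion law `L`. -/
structure IsAxis (L : FusionLaw F) (a : A) : Prop where
  ne_zero : a ≠ 0
  idem : a * a = a
  semisimple : axisEigenspaceSet a L.carrier = ⊤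
  fusion : ∀ l ∈ L.carrier, ∀ m ∈ L.carrier, ∀ u ∈ axisEigenspace a l,
    ∀ v ∈ axisEigenspace a m, u * v ∈ axisEigenspaceSet a (L.star l m)

/-- A primitive axis: an axis whose `1`-eigenspace is spanned by the axis itself. -/
structure IsPrimitiveAxis (L : FusionLaw F) (a : A) : Prop extends IsAxis L a where
  primitive : axisEigenspace a (1 : F) = Submodule.span F {a}

variable (F) in
/-- `(A, X)` is an algebra of Jordan type half: `X` is a set of primitive axes for the fusion law
`𝓙(1/2)`, and `X` generates `A` as an algebra. -/
structure IsJordanTypeHalf (X : Set A) : Prop where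
  primitive : ∀ a ∈ X, IsPrimitiveAxis (jordanLaw (1 / 2 : F)) a
  generates : NonUnitalAlgebra.adjoin F X = ⊤

variable (F A) in
/-- The full automorphism group of the algebra `A`. -/
def AlgAut : Subgroup (A ≃ₗ[F] A) where
  carrier := {φ | ∀ x y, φ (x * y) = φ x * φ y}
  mul_mem' := by
    intro φ ψ hφ hψ x y
    simp only [Set.mem_ofPred_eq] at hφ hψ
    simp [LinearEquiv.mul_apply, hφ, hψ]
  one_mem' := by
    intro x y
    rfl
  inv_mem' := by
    intro φ hφ x y
    simp only [Set.mem_ofPred_eq] at hφ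
    apply φ.injective
    rw [hφ]
    change φ (φ.symm _) = φ (φ.symm _) * φ (φ.symm _)
    simp

variable (F) in
/-- The linear map `1 - 8 ad_a + 8 ad_a²`. It is the identity on the eigenspaces
`A_1(a)` and `A_0(a)`, and it is minus the identity on `A_{1/2}(a)`. -/
def tauLin (a : A) : A →ₗ[F] A :=
  LinearMap.id - (8 : F) • LinearMap.mulLeft F a +
    (8 : F) • (LinearMap.mulLeft F a ∘ₗ LinearMap.mulLeft F a)

theorem tauLin_of_mem {a u : A} {l : F} (hu : u ∈ axisEigenspace a l) :
    tauLin F a u = (1 - 8 * l + 8 * (l * l)) • u := by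
  have h : a * u = l • u := by
    simpa [axisEigenspace, Module.End.mem_eigenspace_iff] using hu
  have h2 : a * (a * u) = (l * l) • u := by rw [h, mul_smul_comm, h, smul_smul]
  simp only [tauLin, LinearMap.add_apply, LinearMap.sub_apply, LinearMap.smul_apply,
    LinearMap.id_apply, LinearMap.comp_apply, LinearMap.mulLeft_apply]
  rw [h2, h]
  module

theorem tauLin_plus {a u : A} (S : Set F) (hS : S ⊆ {1, 0})
    (hu : u ∈ axisEigenspaceSet a S) : tauLin F a u = u := by
  have key : axisEigenspaceSet a S ≤ LinearMap.ker (tauLin F a - LinearMap.id) := by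
    refine iSup₂_le fun l hl x hx => ?_
    rw [LinearMap.mem_ker, LinearMap.sub_apply, tauLin_of_mem hx]
    rcases hS hl with h | h
    · subst h
      norm_num
    · have h' : l = 0 := h
      subst h'
      simp
  have := key hu
  rw [LinearMap.mem_ker, LinearMap.sub_apply, sub_eq_zero] at this
  simpa using this

theorem tauLin_minus [CharZero F] {a u : A} (S : Set F) (hS : S ⊆ {(1 / 2 : F)})
    (hu : u ∈ axisEigenspaceSet a S) : tauLin F a u = -u := by
  have key : axisEigenspaceSet a S ≤ LinearMap.ker (tauLin F a + LinearMap.id) := by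
    refine iSup₂_le fun l hl x hx => ?_
    rw [LinearMap.mem_ker, LinearMap.add_apply, tauLin_of_mem hx]
    have h' : l = 1 / 2 := hS hl
    subst h'
    norm_num
  have := key hu
  rw [LinearMap.mem_ker, LinearMap.add_apply] at this
  exact eq_neg_of_add_eq_zero_left (by simpa using this)

theorem axis_decomp {a : A} (ha : IsAxis (jordanLaw (1 / 2 : F)) a) (w : A) :
    ∃ x ∈ axisEigenspace a (1 : F), ∃ y ∈ axisEigenspace a (0 : F),
      ∃ z ∈ axisEigenspace a (1 / 2 : F), w = x + (y + z) := by
  have hw : w ∈ axisEigenspaceSet a (jordanLaw (1 / 2 : F)).carrier := by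
    rw [ha.semisimple]
    trivial
  simp only [axisEigenspaceSet, jordanLaw, iSup_insert, iSup_singleton, Submodule.mem_sup] at hw
  obtain ⟨x, hx, t, ⟨y, hy, z, hz, rfl⟩, rfl⟩ := hw
  exact ⟨x, hx, y, hy, z, hz, rfl⟩

variable [CharZero F]

theorem tauLin_involutive {a : A} (ha : IsAxis (jordanLaw (1 / 2 : F)) a) :
    Function.Involutive (tauLin F a) := by
  intro w
  obtain ⟨x, hx, y, hy, z, hz, rfl⟩ := axis_decomp ha w
  simp only [map_add, tauLin_of_mem hx, tauLin_of_mem hy, tauLin_of_mem hz, map_smul, smul_smul]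
  norm_num

theorem tauLin_mul {a : A} (ha : IsAxis (jordanLaw (1 / 2 : F)) a) (u v : A) :
    tauLin F a (u * v) = tauLin F a u * tauLin F a v := by
  have m1 : (1 : F) ∈ (jordanLaw (1 / 2 : F)).carrier := by simp [jordanLaw]
  have m0 : (0 : F) ∈ (jordanLaw (1 / 2 : F)).carrier := by simp [jordanLaw]
  have mh : (1 / 2 : F) ∈ (jordanLaw (1 / 2 : F)).carrier := by simp [jordanLaw]
  have e1 : ∀ x ∈ axisEigenspace a (1 : F), tauLin F a x = x := fun x hx => by
    rw [tauLin_of_mem hx]; norm_num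
  have e0 : ∀ x ∈ axisEigenspace a (0 : F), tauLin F a x = x := fun x hx => by
    rw [tauLin_of_mem hx]; norm_num
  have eh : ∀ x ∈ axisEigenspace a (1 / 2 : F), tauLin F a x = -x := fun x hx => by
    rw [tauLin_of_mem hx]; norm_num
  obtain ⟨x, hx, y, hy, z, hz, rfl⟩ := axis_decomp ha u
  obtain ⟨x', hx', y', hy', z', hz', rfl⟩ := axis_decomp ha v
  have plus : ∀ l ∈ (jordanLaw (1 / 2 : F)).carrier, ∀ m ∈ (jordanLaw (1 / 2 : F)).carrier,
      (jordanLaw (1 / 2 : F)).star l m ⊆ {1, 0} → ∀ p ∈ axisEigenspace a l,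
      ∀ q ∈ axisEigenspace a m, tauLin F a (p * q) = p * q :=
    fun l hl m hm hS p hp q hq => tauLin_plus _ hS (ha.fusion l hl m hm p hp q hq)
  have minus : ∀ l ∈ (jordanLaw (1 / 2 : F)).carrier, ∀ m ∈ (jordanLaw (1 / 2 : F)).carrier,
      (jordanLaw (1 / 2 : F)).star l m ⊆ {1 / 2} → ∀ p ∈ axisEigenspace a l,
      ∀ q ∈ axisEigenspace a m, tauLin F a (p * q) = -(p * q) :=
    fun l hl m hm hS p hp q hq => tauLin_minus _ hS (ha.fusion l hl m hm p hp q hq)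
  have p11 := plus 1 m1 1 m1 (by intro n; simp [jordanLaw]; tauto) x hx x' hx'
  have p10 := plus 1 m1 0 m0 (by intro n; simp [jordanLaw]) x hx y' hy'
  have p01 := plus 0 m0 1 m1 (by intro n; simp [jordanLaw]) y hy x' hx'
  have p00 := plus 0 m0 0 m0 (by intro n; simp [jordanLaw]; tauto) y hy y' hy'
  have phh := plus _ mh _ mh (by intro n; simp [jordanLaw]) z hz z' hz'
  have q1h := minus 1 m1 _ mh (by intro n; simp [jordanLaw]) x hx z' hz'
  have q0h := minus 0 m0 _ mh (by intro n; simp [jordanLaw]) y hy z' hz'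
  have qh1 := minus _ mh 1 m1 (by intro n; simp [jordanLaw]) z hz x' hx'
  have qh0 := minus _ mh 0 m0 (by intro n; simp [jordanLaw]) z hz y' hy'
  simp only [map_add, mul_add, add_mul, e1 x hx, e1 x' hx', e0 y hy, e0 y' hy', eh z hz,
    eh z' hz', p11, p10, p01, p00, phh, q1h, q0h, qh1, qh0, mul_neg, neg_mul]
  abel

variable (F) in
open Classical in
/-- The Miyamoto involution `τ_a` of an axis `a` for the law `𝓙(1/2)`, as an automorphism of `A`
(and the identity if `a` is not an axis). -/
def tau (a : A) : AlgAut F A :=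
  if ha : IsAxis (jordanLaw (1 / 2 : F)) a then
    ⟨LinearEquiv.ofInvolutive (tauLin F a) (tauLin_involutive ha), fun x y => tauLin_mul ha x y⟩
  else 1

variable (F) in
/-- The Miyamoto group of `(A, X)`: the group generated by all `τ_a` with `a ∈ X`. -/
def miyamotoGroup (X : Set A) : Subgroup (AlgAut F A) :=
  Subgroup.closure (tau F '' X)

variable (F) in
/-- The closure `{φ(a) | a ∈ X, φ ∈ Miy(A)}` of the generating set of axes `X`. -/
def axisClosure (X : Set A) : Set A :=
  {b | ∃ a ∈ X, ∃ φ ∈ miyamotoGroup F X, (φ : A ≃ₗ[F] A) a = b}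

variable (F) in
/-- The non-identity Miyamoto involutions `τ_a`, with `a` in the closure of `X`, as a subset of
the Miyamoto group. -/
def miyamotoInvolutions (X : Set A) : Set (miyamotoGroup F X) :=
  {g | g ≠ 1 ∧ ∃ a ∈ axisClosure F X, tau F a = (g : AlgAut F A)}

end Axes

/-- `(G, D)` is a 3-transposition group. (`orderOf` is `0` for elements of infinite order.) -/
structure IsThreeTransposition {G : Type u} [Group G] (D : Set G) : Prop where
  closure_eq_top : Subgroup.closure D = ⊤
  conj_mem : ∀ d ∈ D, ∀ g : G, g⁻¹ * d * g ∈ D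
  orderOf_eq_two : ∀ d ∈ D, orderOf d = 2
  orderOf_mul_pos : ∀ c ∈ D, ∀ d ∈ D, 0 < orderOf (c * d)
  orderOf_mul_le : ∀ c ∈ D, ∀ d ∈ D, orderOf (c * d) ≤ 3

section Matsuo

variable {G : Type u} [Group G] {D : Set G}

/-- `c ^ d = d⁻¹ c d` as an element of `D`. -/
def IsThreeTransposition.conj (hD : IsThreeTransposition D) (c d : D) : D :=
  ⟨(d : G)⁻¹ * c * d, hD.conj_mem c c.2 d⟩

/-- The underlying space of the Matsuo algebra `M_η(G, D)` over `F`: the vector space with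
basis `D`. -/
@[nolint unusedArguments]
def Matsuo (F : Type v) [Field F] (_η : F) (_hD : IsThreeTransposition D) : Type (max u v) :=
  D →₀ F

namespace Matsuo

variable {F : Type v} [Field F] {η : F} {hD : IsThreeTransposition D}

instance : AddCommGroup (Matsuo F η hD) := inferInstanceAs (AddCommGroup (D →₀ F))

instance : Module F (Matsuo F η hD) := inferInstanceAs (Module F (D →₀ F))

variable (F η hD) in
/-- The basis of the Matsuo algebra. -/
def basis : Module.Basis D F (Matsuo F η hD) :=
  Module.Basis.ofRepr (LinearEquiv.refl F (D →₀ F))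

variable (F η hD) in
open Classical in
/-- The product of two basis elements. -/
def basisMul (c d : D) : Matsuo F η hD :=
  if c = d then basis F η hD c
  else if orderOf ((c : G) * d) = 3 then
    (η / 2) • (basis F η hD c + basis F η hD d - basis F η hD (hD.conj c d))
  else 0

variable (F η hD) in
/-- The bilinear extension of `basisMul`. -/
def mulLin : Matsuo F η hD →ₗ[F] Matsuo F η hD →ₗ[F] Matsuo F η hD :=
  (basis F η hD).constr F fun c => (basis F η hD).constr F fun d => basisMul F η hD c d

theorem mulLin_basis (c d : D) :
    mulLin F η hD (basis F η hD c) (basis F η hD d) = basisMul F η hD c d := by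
  simp [mulLin]

theorem conj_comm {c d : D} (h : orderOf ((c : G) * d) = 3) : hD.conj c d = hD.conj d c := by
  have hc : (c : G) * c = 1 := by
    have := pow_orderOf_eq_one (c : G)
    rwa [hD.orderOf_eq_two c c.2, pow_two] at this
  have hd : (d : G) * d = 1 := by
    have := pow_orderOf_eq_one (d : G)
    rwa [hD.orderOf_eq_two d d.2, pow_two] at this
  have h3 : ((c : G) * d) * (c * d) * (c * d) = 1 := by
    have := pow_orderOf_eq_one ((c : G) * d)
    rwa [h, pow_succ, pow_two] at this
  apply Subtype.ext
  change (d : G)⁻¹ * c * d = (c : G)⁻¹ * d * c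
  have ic : (c : G)⁻¹ = c := inv_eq_of_mul_eq_one_left hc
  have id' : (d : G)⁻¹ = d := inv_eq_of_mul_eq_one_left hd
  rw [ic, id']
  have h4 : ((c : G) * d * c) * (d * c * d) = 1 := by simpa [mul_assoc] using h3
  have h5 : ((d : G) * c * d) * (d * c * d) = 1 := by
    calc ((d : G) * c * d) * (d * c * d) = d * (c * (d * d) * c) * d := by group
      _ = 1 := by rw [hd, mul_one, hc, mul_one, hd]
  exact mul_right_cancel (h5.trans h4.symm)

theorem basisMul_comm (c d : D) : basisMul F η hD c d = basisMul F η hD d c := by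
  have ho : orderOf ((c : G) * d) = orderOf ((d : G) * c) := by
    have ic : (c : G) * c = 1 := by
      have := pow_orderOf_eq_one (c : G)
      rwa [hD.orderOf_eq_two c c.2, pow_two] at this
    have id' : (d : G) * d = 1 := by
      have := pow_orderOf_eq_one (d : G)
      rwa [hD.orderOf_eq_two d d.2, pow_two] at this
    rw [← orderOf_inv ((c : G) * d), mul_inv_rev, inv_eq_of_mul_eq_one_left ic,
      inv_eq_of_mul_eq_one_left id']
  unfold basisMul
  by_cases h : c = d
  · simp [h]
  · by_cases h3 : orderOf ((c : G) * d) = 3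
    · rw [if_neg h, if_pos h3, if_neg (Ne.symm h), if_pos (ho ▸ h3), conj_comm h3, add_comm]
    · rw [if_neg h, if_neg h3, if_neg (Ne.symm h), if_neg (ho ▸ h3)]

theorem mulLin_comm (x y : Matsuo F η hD) : mulLin F η hD x y = mulLin F η hD y x := by
  have : mulLin F η hD = (mulLin F η hD).flip := by
    refine (basis F η hD).ext fun c => (basis F η hD).ext fun d => ?_
    rw [LinearMap.flip_apply, mulLin_basis, mulLin_basis, basisMul_comm]
  conv_lhs => rw [this]
  rfl

instance : NonUnitalNonAssocCommRing (Matsuo F η hD) where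
  mul := fun x y => mulLin F η hD x y
  left_distrib := fun x y z => (mulLin F η hD x).map_add y z
  right_distrib := fun x y z => (mulLin F η hD).map_add₂ x y z
  zero_mul := fun x => (mulLin F η hD).map_zero₂ x
  mul_zero := fun x => (mulLin F η hD x).map_zero
  mul_comm := mulLin_comm

theorem basis_mul_basis (c d : D) :
    basis F η hD c * basis F η hD d = basisMul F η hD c d :=
  mulLin_basis c d

instance : IsScalarTower F (Matsuo F η hD) (Matsuo F η hD) where
  smul_assoc := fun r x y => (mulLin F η hD).map_smul₂ r x y

instance : SMulCommClass F (Matsuo F η hD) (Matsuo F η hD) where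
  smul_comm := fun r x y => ((mulLin F η hD x).map_smul r y).symm

end Matsuo

end Matsuo

section ThreeC

/-- The underlying space of the algebra `3C(η)`, with basis `e 0, e 1, e 2` indexed by `Fin 3`. -/
@[nolint unusedArguments]
def ThreeC (F : Type v) [Field F] (_η : F) : Type v :=
  Fin 3 → F

namespace ThreeC

variable {F : Type v} [Field F] {η : F}

instance : AddCommGroup (ThreeC F η) := inferInstanceAs (AddCommGroup (Fin 3 → F))

instance : Module F (ThreeC F η) := inferInstanceAs (Module F (Fin 3 → F))

variable (η) in
/-- The standard basis vectors. -/
def e (i : Fin 3) : ThreeC F η := (Pi.single i 1 : Fin 3 → F)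

/-- The multiplication in coordinates: it is the bilinear extension of `e i * e i = e i` and
`e i * e j = (η / 2) • (e i + e j - e k)` for `{i, j, k} = {0, 1, 2}`. -/
def mulFun (x y : Fin 3 → F) : Fin 3 → F := fun i =>
  x i * y i + η / 2 * (x i * y (i + 1) + x (i + 1) * y i + x i * y (i + 2) + x (i + 2) * y i
    - x (i + 1) * y (i + 2) - x (i + 2) * y (i + 1))

instance : NonUnitalNonAssocCommRing (ThreeC F η) where
  mul := fun x y => mulFun (η := η) x y
  left_distrib := fun x y z => funext fun i => by
    change mulFun (η := η) x (fun j => y j + z j) i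
      = mulFun (η := η) x y i + mulFun (η := η) x z i
    simp only [mulFun]
    ring
  right_distrib := fun x y z => funext fun i => by
    change mulFun (η := η) (fun j => x j + y j) z i
      = mulFun (η := η) x z i + mulFun (η := η) y z i
    simp only [mulFun]
    ring
  zero_mul := fun x => funext fun i => by
    change mulFun (η := η) (fun _ => 0) x i = 0
    simp [mulFun]
  mul_zero := fun x => funext fun i => by
    change mulFun (η := η) x (fun _ => 0) i = 0
    simp [mulFun]
  mul_comm := fun x y => funext fun i => by
    change mulFun (η := η) x y i = mulFun (η := η) y x i
    simp only [mulFun]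
    ring

theorem e_mul_self (i : Fin 3) : e η i * e η i = e η i := by
  change mulFun (η := η) (Pi.single i 1) (Pi.single i 1) = Pi.single i 1
  funext j
  fin_cases i <;> fin_cases j <;> simp [mulFun]

theorem e_mul_succ (i : Fin 3) :
    e η i * e η (i + 1) = (η / 2) • (e η i + e η (i + 1) - e η (i + 2)) := by
  funext j
  change mulFun (η := η) (Pi.single i 1) (Pi.single (i + 1) 1) j = (η / 2) *
    ((Pi.single i 1 : Fin 3 → F) j + (Pi.single (i + 1) 1 : Fin 3 → F) j
      - (Pi.single (i + 2) 1 : Fin 3 → F) j)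
  fin_cases i <;> fin_cases j <;> simp [mulFun]

end ThreeC

end ThreeC

section Conclusions

variable (F : Type v) [Field F] {A : Type u} [NonUnitalNonAssocCommRing A] [Module F A]
  [IsScalarTower F A A] [SMulCommClass F A A]

variable (A) in
/-- `A` is a Matsuo algebra `M_{1/2}(G, D)` or a factor of one: there is a surjective algebra
homomorphism from some `M_{1/2}(G, D)` onto `A`. -/
def IsMatsuoOrFactor : Prop :=
  ∃ (G : Type u) (_ : Group G) (D : Set G) (hD : IsThreeTransposition D)
    (f : Matsuo F (1 / 2) hD →ₙₐ[F] A), Function.Surjective f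

/-- The subalgebra generated by `a` and `b` is the algebra `2B = F ⊕ F`, with `a` and `b`
corresponding to `(1, 0)` and `(0, 1)`. -/
def Generates2B (a b : A) : Prop :=
  ∃ f : F × F →ₙₐ[F] A, Function.Injective f ∧
    NonUnitalAlgHom.range f = NonUnitalAlgebra.adjoin F {a, b} ∧ f (1, 0) = a ∧ f (0, 1) = b

/-- The subalgebra generated by `a` and `b` is the algebra `3C(1/2)`, with `a`, `b` and the
element `c` corresponding to the three basis vectors. -/
def Generates3CHalf (a b c : A) : Prop :=
  ∃ f : ThreeC F (1 / 2) →ₙₐ[F] A, Function.Injective f ∧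
    NonUnitalAlgHom.range f = NonUnitalAlgebra.adjoin F {a, b} ∧
    f (ThreeC.e _ 0) = a ∧ f (ThreeC.e _ 1) = b ∧ f (ThreeC.e _ 2) = c

end Conclusions

end

/-! The proof rests on the observation that being a primitive axis is a *quadratic* condition. Let
`B` be the associating form of `A`, for which the projection of an axis `a` is `x ↦ B a x • a`; it
exists because primitive axes span `A` and their projections satisfy the symmetry `B a b = B b a`
(`exists_isAxisForm`). An element `e ≠ 0` is a primitive axis with projection `B e` if and only if
it satisfies the four identities of `AxisIdentities`, and each of these is quadratic in `e`.

Let `a`, `b` be axes and `α = B a b`. The five axes `τ_a(b)`, `a`, `b`, `τ_b(a)`, `τ_a(τ_b(a))` lie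
on a conic in the span of the first three (where coefficients sum to `1`). If `α` is not `1/4` or
`1/2`, then a quadratic map that vanishes at these five points vanishes on the whole conic, so all
nonzero points of the conic are axes; for `α ≠ 0, 1` a rational parametrization of the conic gives
infinitely many of them (`IsAxisForm.infinite_of_generic`). For `α = 1/2` there are only four
different points, and one more linear condition is needed: the polarization of the identities in
two orthogonal directions vanishes. It is read off from the joint Peirce decomposition of the
orthogonal axes `a` and `τ_b(a)` (`IsAxisFrame.identityBilin_add_eq_zero`). For `α = 0` and `α = 1`
the automorphism `τ_b τ_a` is unipotent on that span, so that in characteristic zero the orbit of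
`a` is infinite unless `a b = 0` or `a = b`, respectively.

Hence, if there are finitely many axes, two distinct axes satisfy `a b = 0` or `B a b = 1/4`, and
span `2B` or `3C(1/2)`. Accordingly `τ_a` and `τ_b` commute or satisfy the braid relation, and the
products are those of the Matsuo algebra. Moreover an axis is determined by its Miyamoto involution
if that is nontrivial (`AxisPairs.eq_of_tau_eq`), which gives the homomorphism from the Matsuo
algebra. Axes with trivial Miyamoto involution are fixed by all others; to include them, the group
is enlarged by a central involution for each of them (`extendedTau`). -/

set_option linter.unusedSectionVars false

/-! ### The quadratic identities of a primitive axis -/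

section Identities

variable {F : Type v} [Field F] {A : Type u} [NonUnitalNonAssocCommRing A] [Module F A]
  [IsScalarTower F A A] [SMulCommClass F A A]

variable (F) in
/-- Primitive axes for the fusion law `𝓙(1/2)`. -/
abbrev IsHalfAxis (a : A) : Prop := IsPrimitiveAxis (jordanLaw (1 / 2 : F)) a

/-- The identities in `e` that, together with `e ≠ 0`, say that `e` is a primitive axis for
`𝓙(1/2)` whose projection to `A_1(e)` is `x ↦ β x • e`. If `β` depends linearly on `e`, each of
them is a quadratic equation in `e`. -/
structure AxisIdentities (β : A →ₗ[F] F) (e : A) : Prop where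
  /-- `e` is idempotent. -/
  idem : e * e = e
  /-- `2 ad_e² - ad_e` is the projection to `A_1(e)`, and its image lies in `F e`. -/
  proj : ∀ x, (2 : F) • (e * (e * x)) = e * x + β x • e
  /-- Multiplication by `y - 2 e y`, which lies in `F e + A_0(e)`, commutes with `ad_e`. -/
  seress : ∀ y z, e * (y * z) + (2 : F) • ((e * y) * (e * z)) =
    (2 : F) • (e * ((e * y) * z)) + y * (e * z)
  /-- Modulo the other identities, `A_{1/2}(e) A_{1/2}(e) ⊆ F e + A_0(e)`. -/
  half : ∀ y z, e * (y * z) + (4 : F) • ((e * y) * (e * z)) =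
    y * (e * z) + z * (e * y) + β y • (e * z) + β z • (e * y) + β (y * z) • e

theorem mem_axisEigenspace {a u : A} {l : F} : u ∈ axisEigenspace a l ↔ a * u = l • u := by
  simp [axisEigenspace]

theorem mem_axisEigenspaceSet {a u : A} {l : F} {S : Set F} (hl : l ∈ S) (hu : a * u = l • u) :
    u ∈ axisEigenspaceSet a S :=
  (le_iSup₂ (f := fun l (_ : l ∈ S) => axisEigenspace a l) l hl) (mem_axisEigenspace.2 hu)

theorem mul_eq_of_mem_axisEigenspaceSet {a u : A} {l : F} {S : Set F} (hS : S ⊆ {l})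
    (hu : u ∈ axisEigenspaceSet a S) : a * u = l • u := by
  refine mem_axisEigenspace.1 ((iSup₂_le fun m hm => ?_ : axisEigenspaceSet a S ≤ _) hu)
  rw [show m = l from hS hm]

namespace IsPrimitiveAxis

variable {a : A}

theorem eq_smul (ha : IsHalfAxis F a) {u : A} (hu : a * u = u) : ∃ ξ : F, u = ξ • a := by
  have : u ∈ axisEigenspace a (1 : F) := mem_axisEigenspace.2 (by simpa using hu)
  rw [ha.primitive, Submodule.mem_span_singleton] at this
  obtain ⟨ξ, h⟩ := this
  exact ⟨ξ, h.symm⟩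

variable [CharZero F]

theorem mul_zero_zero (ha : IsHalfAxis F a) {u v : A} (hu : a * u = 0) (hv : a * v = 0) :
    a * (u * v) = 0 := by
  have := ha.fusion 0 (by simp [jordanLaw]) 0 (by simp [jordanLaw]) u
    (mem_axisEigenspace.2 (by simpa using hu)) v (mem_axisEigenspace.2 (by simpa using hv))
  simpa using mul_eq_of_mem_axisEigenspaceSet (l := 0) (by intro n; simp [jordanLaw]) this

theorem mul_zero_half (ha : IsHalfAxis F a) {u v : A} (hu : a * u = 0)
    (hv : a * v = (1 / 2 : F) • v) : a * (u * v) = (1 / 2 : F) • (u * v) := by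
  have := ha.fusion 0 (by simp [jordanLaw]) (1 / 2) (by simp [jordanLaw]) u
    (mem_axisEigenspace.2 (by simpa using hu)) v (mem_axisEigenspace.2 hv)
  exact mul_eq_of_mem_axisEigenspaceSet (by intro n; simp [jordanLaw]) this

theorem mul_half_half (ha : IsHalfAxis F a) {u v : A} (hu : a * u = (1 / 2 : F) • u)
    (hv : a * v = (1 / 2 : F) • v) : ∃ (ξ : F) (w : A), a * w = 0 ∧ u * v = ξ • a + w := by
  have := ha.fusion (1 / 2) (by simp [jordanLaw]) (1 / 2) (by simp [jordanLaw]) u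
    (mem_axisEigenspace.2 hu) v (mem_axisEigenspace.2 hv)
  have hle : axisEigenspaceSet a ((jordanLaw (1 / 2 : F)).star (1 / 2) (1 / 2)) ≤
      axisEigenspace a 1 ⊔ axisEigenspace a 0 := by
    refine iSup₂_le fun m hm => ?_
    simp only [jordanLaw, Set.mem_ofPred_eq] at hm
    have : m = 1 ∨ m = 0 := by
      revert hm; norm_num
    rcases this with rfl | rfl
    · exact le_sup_left
    · exact le_sup_right
  obtain ⟨x, hx, w, hw, h⟩ := Submodule.mem_sup.1 (hle this)
  obtain ⟨ξ, rfl⟩ := ha.eq_smul (by simpa using mem_axisEigenspace.1 hx)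
  exact ⟨ξ, w, by simpa using mem_axisEigenspace.1 hw, h.symm⟩

theorem exists_decomp (ha : IsHalfAxis F a) (x : A) :
    ∃ (ξ : F) (x₀ x₁ : A), a * x₀ = 0 ∧ a * x₁ = (1 / 2 : F) • x₁ ∧ x = ξ • a + x₀ + x₁ := by
  obtain ⟨p, hp, q, hq, r, hr, rfl⟩ := axis_decomp ha.toIsAxis x
  obtain ⟨ξ, rfl⟩ := ha.eq_smul (by simpa using mem_axisEigenspace.1 hp)
  exact ⟨ξ, q, r, by simpa using mem_axisEigenspace.1 hq, mem_axisEigenspace.1 hr, by abel⟩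

theorem exists_axisIdentities (ha : IsHalfAxis F a) :
    ∃ β : A →ₗ[F] F, AxisIdentities β a := by
  obtain ⟨g, hg⟩ : ∃ g : A →ₗ[F] F, g a = 1 := by
    obtain ⟨g, hg⟩ := not_forall.1 (mt (Module.forall_dual_apply_eq_zero_iff F a).1 ha.ne_zero)
    exact ⟨(g a)⁻¹ • g, by simp [inv_mul_cancel₀ hg]⟩
  set L := LinearMap.mulLeft F a with hL
  set β : A →ₗ[F] F := g ∘ₗ ((2 : F) • (L ∘ₗ L) - L) with hβ
  have idem : a * a = a := ha.idem
  have hβ' : ∀ x, β x = 2 * g (a * (a * x)) - g (a * x) := fun x => by simp [hβ, hL]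
  have βa : β a = 1 := by rw [hβ', idem, idem, hg]; norm_num
  have β0 : ∀ {x}, a * x = 0 → β x = 0 := fun {x} h => by rw [hβ', h]; simp
  have βh : ∀ {x}, a * x = (1 / 2 : F) • x → β x = 0 := fun {x} h => by
    rw [hβ', h, mul_smul_comm, h]; simp
  refine ⟨β, idem, fun x => ?_, fun y z => ?_, fun y z => ?_⟩
  · obtain ⟨ξ, x₀, x₁, h₀, h₁, rfl⟩ := ha.exists_decomp x
    simp only [mul_add, mul_smul_comm, idem, h₀, h₁, map_add, map_smul, βa, β0 h₀, βh h₁,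
      mul_zero]
    simp only [smul_eq_mul]
    module
  · obtain ⟨η, y₀, y₁, hy₀, hy₁, rfl⟩ := ha.exists_decomp y
    obtain ⟨ζ, z₀, z₁, hz₀, hz₁, rfl⟩ := ha.exists_decomp z
    obtain ⟨ξ, w, hw, h⟩ := ha.mul_half_half hy₁ hz₁
    have e1 := ha.mul_zero_zero hy₀ hz₀
    have e2 := ha.mul_zero_half hy₀ hz₁
    have e3 := ha.mul_zero_half hz₀ hy₁
    simp only [mul_add, add_mul, smul_mul_assoc, mul_smul_comm, idem, hy₀, hy₁, hz₀, hz₁,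
      mul_zero, zero_mul, mul_comm _ a, mul_comm y₁ z₀, e1, e2, e3, h, hw, smul_add, smul_zero]
    module
  · obtain ⟨η, y₀, y₁, hy₀, hy₁, rfl⟩ := ha.exists_decomp y
    obtain ⟨ζ, z₀, z₁, hz₀, hz₁, rfl⟩ := ha.exists_decomp z
    obtain ⟨ξ, w, hw, h⟩ := ha.mul_half_half hy₁ hz₁
    have e1 := ha.mul_zero_zero hy₀ hz₀
    have e2 := ha.mul_zero_half hy₀ hz₁
    have e3 := ha.mul_zero_half hz₀ hy₁
    simp only [mul_add, add_mul, smul_mul_assoc, mul_smul_comm, idem, hy₀, hy₁, hz₀, hz₁,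
      mul_zero, zero_mul, mul_comm _ a, mul_comm y₁ z₀, mul_comm z₁ y₁, e1, e2,
      e3, h, hw, smul_add, smul_zero, map_add, map_smul, βa, β0 hy₀, βh hy₁, β0 hz₀, βh hz₁,
      β0 e1, βh e2, βh e3, β0 hw, map_zero, smul_eq_mul]
    module

end IsPrimitiveAxis

namespace AxisIdentities

variable {β : A →ₗ[F] F} {e : A}

theorem apply_self (h : AxisIdentities β e) (he : e ≠ 0) : β e = 1 := by
  have := h.proj e
  rw [h.idem, h.idem] at this
  have h2 : (β e - 1) • e = 0 := by linear_combination (norm := module) -this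
  simpa [he, sub_eq_zero] using h2

theorem eq_of_mul_eq (h : AxisIdentities β e) {x : A} (hx : e * x = x) : x = β x • e := by
  have := h.proj x
  rw [hx, hx] at this
  linear_combination (norm := module) this

theorem smul_eq_zero_of_half [CharZero F] (h : AxisIdentities β e) {x : A}
    (hx : e * x = (1 / 2 : F) • x) : β x • e = 0 := by
  have := h.proj x
  rw [hx, mul_smul_comm, hx] at this
  linear_combination (norm := module) -this

theorem apply_eq_zero_of_half [CharZero F] (h : AxisIdentities β e) (he : e ≠ 0) {x : A}
    (hx : e * x = (1 / 2 : F) • x) : β x = 0 := by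
  simpa [he] using h.smul_eq_zero_of_half hx

theorem apply_eq_zero_of_mul_eq_zero (h : AxisIdentities β e) (he : e ≠ 0) {x : A}
    (hx : e * x = 0) : β x = 0 := by
  have := h.proj x
  rw [hx, mul_zero, smul_zero, zero_add] at this
  simpa [he] using this.symm

theorem mul_zero_left (h : AxisIdentities β e) {y : A} (hy : e * y = 0) (z : A) :
    e * (y * z) = y * (e * z) := by
  simpa [hy] using h.seress y z

theorem mul_half_half [CharZero F] (h : AxisIdentities β e) {x y : A}
    (hx : e * x = (1 / 2 : F) • x) (hy : e * y = (1 / 2 : F) • y) :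
    e * (x * y) = β (x * y) • e := by
  have h1 := h.half x y
  rw [hx, hy] at h1
  simp only [smul_mul_assoc, mul_smul_comm] at h1
  by_cases he : e = 0
  · simp [he]
  rw [h.apply_eq_zero_of_half he hx, h.apply_eq_zero_of_half he hy, mul_comm y x] at h1
  linear_combination (norm := module) h1

theorem isPrimitiveAxis [CharZero F] (h : AxisIdentities β e) (he : e ≠ 0) : IsHalfAxis F e where
  ne_zero := he
  idem := h.idem
  semisimple := by
    rw [eq_top_iff]
    intro x _
    have hx : x = β x • e + (x - (2 : F) • (e * x) + β x • e) +
        (2 : F) • (e * x - β x • e) := by module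
    have hp := h.proj x
    rw [hx]
    refine add_mem (add_mem ?_ ?_) ?_
    · exact mem_axisEigenspaceSet (l := 1) (by simp [jordanLaw]) (by simp [mul_smul_comm, h.idem])
    · refine mem_axisEigenspaceSet (l := 0) (by simp [jordanLaw]) ?_
      simp only [mul_add, mul_sub, mul_smul_comm, h.idem, hp]
      module
    · refine mem_axisEigenspaceSet (l := 1 / 2) (by simp [jordanLaw]) ?_
      simp only [mul_sub, mul_smul_comm, h.idem]
      linear_combination (norm := module) hp
  primitive := by
    ext x
    rw [mem_axisEigenspace, Submodule.mem_span_singleton, one_smul]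
    constructor
    · exact fun hx => ⟨β x, (h.eq_of_mul_eq hx).symm⟩
    · rintro ⟨c, rfl⟩
      simp only [mul_smul_comm, h.idem]
  fusion := by
    have key : ∀ {x y : A}, e * x = 0 → e * y = (1 / 2 : F) • y →
        e * (x * y) = (1 / 2 : F) • (x * y) := fun hx hy => by
      rw [h.mul_zero_left hx, hy, mul_smul_comm]
    intro l hl m hm x hx y hy
    rw [mem_axisEigenspace] at hx hy
    simp only [jordanLaw, Set.mem_insert_iff, Set.mem_singleton_iff] at hl hm
    rcases hl with rfl | rfl | rfl <;> rcases hm with rfl | rfl | rfl <;>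
      try simp only [one_smul, zero_smul] at hx hy
    · rw [h.eq_of_mul_eq hx, h.eq_of_mul_eq hy]
      exact mem_axisEigenspaceSet (l := 1) (by simp [jordanLaw])
        (by simp [smul_mul_assoc, mul_smul_comm, h.idem])
    · rw [h.eq_of_mul_eq hx, smul_mul_assoc, hy, smul_zero]
      exact zero_mem _
    · rw [h.eq_of_mul_eq hx, smul_mul_assoc, hy]
      exact mem_axisEigenspaceSet (l := 1 / 2) (by simp [jordanLaw])
        (by simp only [mul_smul_comm, hy]; module)
    · rw [h.eq_of_mul_eq hy, mul_smul_comm, mul_comm, hx, smul_zero]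
      exact zero_mem _
    · exact mem_axisEigenspaceSet (l := 0) (by simp [jordanLaw])
        (by rw [h.mul_zero_left hx, hy]; simp)
    · exact mem_axisEigenspaceSet (l := 1 / 2) (by simp [jordanLaw]) (key hx hy)
    · rw [h.eq_of_mul_eq hy, mul_smul_comm, mul_comm, hx]
      exact mem_axisEigenspaceSet (l := 1 / 2) (by simp [jordanLaw])
        (by simp only [mul_smul_comm, hx]; module)
    · rw [mul_comm]
      exact mem_axisEigenspaceSet (l := 1 / 2) (by simp [jordanLaw]) (key hy hx)
    · have := h.mul_half_half hx hy
      rw [show x * y = β (x * y) • e + (x * y - β (x * y) • e) by module]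
      refine add_mem ?_ ?_
      · exact mem_axisEigenspaceSet (l := 1) (by simp [jordanLaw]) (by simp [mul_smul_comm, h.idem])
      · refine mem_axisEigenspaceSet (l := 0) (by simp [jordanLaw]) ?_
        rw [mul_sub, this, mul_smul_comm, h.idem]
        simp

end AxisIdentities

end Identities

/-! ### Miyamoto involutions and the associating form -/

section Form

variable {F : Type v} [Field F] {A : Type u} [NonUnitalNonAssocCommRing A] [Module F A]
  [IsScalarTower F A A] [SMulCommClass F A A]

theorem AxisIdentities.map {β : A →ₗ[F] F} {e : A} (h : AxisIdentities β e) (g : AlgAut F A) :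
    AxisIdentities (β ∘ₗ ((g : A ≃ₗ[F] A).symm : A →ₗ[F] A)) ((g : A ≃ₗ[F] A) e) := by
  obtain ⟨g, hg⟩ := g
  have hg : ∀ x y, g (x * y) = g x * g y := hg
  refine ⟨?_, fun x => ?_, fun y z => ?_, fun y z => ?_⟩
  · rw [← hg, h.idem]
  · obtain ⟨x, rfl⟩ := g.surjective x
    simpa [hg] using congrArg g (h.proj x)
  · obtain ⟨y, rfl⟩ := g.surjective y
    obtain ⟨z, rfl⟩ := g.surjective z
    simpa [hg] using congrArg g (h.seress y z)
  · obtain ⟨y, rfl⟩ := g.surjective y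
    obtain ⟨z, rfl⟩ := g.surjective z
    have := congrArg g (h.half y z)
    simp only [map_add, map_smul, hg] at this
    simpa only [LinearMap.comp_apply, LinearEquiv.coe_coe, LinearEquiv.symm_apply_apply, ← hg y z,
      hg y (_ * _), hg z (_ * _), hg e] using this

variable [CharZero F]

theorem IsPrimitiveAxis.map {a : A} (ha : IsHalfAxis F a) (g : AlgAut F A) :
    IsHalfAxis F ((g : A ≃ₗ[F] A) a) := by
  obtain ⟨β, hβ⟩ := ha.exists_axisIdentities
  exact (hβ.map g).isPrimitiveAxis (by simpa using ha.ne_zero)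

theorem tau_eq_tauLin {a : A} (ha : IsHalfAxis F a) (x : A) :
    (tau F a : A ≃ₗ[F] A) x = tauLin F a x := by
  rw [tau, dif_pos ha.toIsAxis]
  rfl

theorem tau_apply {a : A} (ha : IsHalfAxis F a) {β : A →ₗ[F] F} (hβ : AxisIdentities β a)
    (x : A) : (tau F a : A ≃ₗ[F] A) x = x - (4 : F) • (a * x) + (4 * β x) • a := by
  rw [tau_eq_tauLin ha]
  simp only [tauLin, LinearMap.add_apply, LinearMap.sub_apply, LinearMap.smul_apply,
    LinearMap.id_apply, LinearMap.comp_apply, LinearMap.mulLeft_apply]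
  linear_combination (norm := module) (4 : F) • hβ.proj x

theorem tau_mul (a x y : A) : (tau F a : A ≃ₗ[F] A) (x * y) =
    (tau F a : A ≃ₗ[F] A) x * (tau F a : A ≃ₗ[F] A) y :=
  (tau F a).2 x y

theorem tau_tau {a : A} (ha : IsHalfAxis F a) (x : A) :
    (tau F a : A ≃ₗ[F] A) ((tau F a : A ≃ₗ[F] A) x) = x := by
  rw [tau_eq_tauLin ha, tau_eq_tauLin ha, tauLin_involutive ha.toIsAxis]

theorem tau_mul_self {a : A} (ha : IsHalfAxis F a) : tau F a * tau F a = 1 :=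
  Subtype.ext (LinearEquiv.ext fun x => tau_tau ha x)

theorem tau_inv {a : A} (ha : IsHalfAxis F a) : (tau F a)⁻¹ = tau F a :=
  inv_eq_of_mul_eq_one_left (tau_mul_self ha)

theorem tau_self {a : A} (ha : IsHalfAxis F a) : (tau F a : A ≃ₗ[F] A) a = a := by
  rw [tau_eq_tauLin ha, tauLin_of_mem (l := 1) (mem_axisEigenspace.2 (by simpa using ha.idem))]
  norm_num

theorem IsPrimitiveAxis.tau {a b : A} (ha : IsHalfAxis F a) :
    IsHalfAxis F ((tau F b : A ≃ₗ[F] A) a) :=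
  ha.map (_root_.tau F b)

/-- Automorphisms conjugate Miyamoto involutions to Miyamoto involutions. -/
theorem tau_map {a : A} (ha : IsHalfAxis F a) (g : AlgAut F A) :
    tau F ((g : A ≃ₗ[F] A) a) = g * tau F a * g⁻¹ := by
  rw [eq_mul_inv_iff_mul_eq]
  refine Subtype.ext (LinearEquiv.ext fun x => ?_)
  change (tau F ((g : A ≃ₗ[F] A) a) : A ≃ₗ[F] A) ((g : A ≃ₗ[F] A) x) =
    (g : A ≃ₗ[F] A) ((tau F a : A ≃ₗ[F] A) x)
  rw [tau_eq_tauLin ha, tau_eq_tauLin (ha.map g)]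
  have hg : ∀ x y, (g : A ≃ₗ[F] A) (x * y) = (g : A ≃ₗ[F] A) x * (g : A ≃ₗ[F] A) y := g.2
  simp [tauLin, hg]

theorem AxisIdentities.apply_comm {β γ : A →ₗ[F] F} {a b : A} (ha : AxisIdentities β a)
    (hb : AxisIdentities γ b) (ha₀ : a ≠ 0) (hb₀ : b ≠ 0) : β b = γ a := by
  -- `key` is not symmetric in `a` and `b`: exchanging them shows `(γ a - β b) • (a * b) = 0`
  have key : ∀ {β γ : A →ₗ[F] F} {a b : A}, AxisIdentities β a → AxisIdentities γ b →
      (2 : F) • ((a * b) * (a * b)) = (1 / 2 * β b) • a + (1 / 2 * γ a) • b + γ a • (a * b) := by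
    intro β γ a b ha hb
    have h1 := ha.seress b b
    have h2 := ha.proj b
    have h3 := hb.proj a
    have h4 : a * (b * (b * a)) = (1 / 2 : F) • (a * (a * b)) + (1 / 2 * γ a) • (a * b) := by
      have := congrArg (a * ·) h3
      simp only [mul_add, mul_smul_comm, mul_comm b a] at this
      rw [mul_comm b a]
      linear_combination (norm := module) (1 / 2 : F) • this
    rw [hb.idem, mul_comm (a * b) b, mul_comm a b, h4] at h1
    rw [mul_comm b a] at h1 h3
    linear_combination (norm := module) h1 + (1 / 2 : F) • h2 + (1 / 2 : F) • h3
  have h1 := key ha hb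
  have h2 := key hb ha
  rw [mul_comm b a] at h2
  have h3 : (γ a - β b) • (a * b) = 0 := by
    linear_combination (norm := module) h2 - h1
  rcases smul_eq_zero.1 h3 with h | h
  · exact (sub_eq_zero.1 h).symm
  · rw [ha.apply_eq_zero_of_mul_eq_zero ha₀ h,
      hb.apply_eq_zero_of_mul_eq_zero hb₀ (by rw [mul_comm, h])]

/-- Primitive axes span `A`, since `a * b` is a combination of `a`, `b` and `τ_a(b)`. -/
theorem IsJordanTypeHalf.span_axes {X : Set A} (hX : IsJordanTypeHalf F X) :
    Submodule.span F {a : A | IsHalfAxis F a} = ⊤ := by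
  set S := Submodule.span F {a : A | IsHalfAxis F a}
  have hmul : ∀ x ∈ S, ∀ y ∈ S, x * y ∈ S := by
    intro x hx y hy
    induction hx using Submodule.span_induction with
    | mem a ha =>
      have ha : IsHalfAxis F a := ha
      induction hy using Submodule.span_induction with
      | mem b hb =>
        have hb : IsHalfAxis F b := hb
        obtain ⟨β, hβ⟩ := ha.exists_axisIdentities
        have := tau_apply ha hβ b
        have h : a * b = (1 / 4 : F) • (b - (tau F a : A ≃ₗ[F] A) b) + β b • a := by
          rw [this]; module
        rw [h]
        exact add_mem (S.smul_mem _ (sub_mem (Submodule.subset_span hb)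
          (Submodule.subset_span hb.tau))) (S.smul_mem _ (Submodule.subset_span ha))
      | zero => simp
      | add y z _ _ h1 h2 => rw [mul_add]; exact add_mem h1 h2
      | smul c y _ h => rw [mul_smul_comm]; exact S.smul_mem c h
    | zero => simp
    | add y z _ _ h1 h2 => rw [add_mul]; exact add_mem h1 h2
    | smul c y _ h => rw [smul_mul_assoc]; exact S.smul_mem c h
  rw [eq_top_iff]
  intro x _
  have hx : x ∈ NonUnitalAlgebra.adjoin F X := by rw [hX.generates]; trivial
  induction hx using NonUnitalAlgebra.adjoin_induction with
  | mem a ha => exact Submodule.subset_span (hX.primitive a ha)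
  | add y z _ _ h1 h2 => exact add_mem (h1 trivial) (h2 trivial)
  | zero => exact zero_mem _
  | mul y z _ _ h1 h2 => exact hmul _ (h1 trivial) _ (h2 trivial)
  | smul c y _ h => exact S.smul_mem c (h trivial)

/-- The associating (Frobenius) form of an algebra of Jordan type half: a symmetric form that
associates with the product and gives the projection of every primitive axis. -/
structure IsAxisForm (B : A →ₗ[F] A →ₗ[F] F) : Prop where
  identities : ∀ a, IsHalfAxis F a → AxisIdentities (B a) a
  comm : ∀ x y, B x y = B y x
  assoc : ∀ x y z, B (x * y) z = B y (x * z)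

/-- The form is well defined because `B a b = B b a` on the spanning set of primitive axes, and it
associates because it is invariant under the Miyamoto involutions. -/
theorem exists_isAxisForm (hS : Submodule.span F {a : A | IsHalfAxis F a} = ⊤) :
    ∃ B : A →ₗ[F] A →ₗ[F] F, IsAxisForm B := by
  set P := {a : A // IsHalfAxis F a}
  choose φ hφ using fun a : P => a.2.exists_axisIdentities
  set T := Finsupp.linearCombination F (Subtype.val : P → A)
  set S := Finsupp.linearCombination F φ
  have hT : LinearMap.range T = ⊤ := by
    rw [Finsupp.range_linearCombination, ← hS]
    exact congrArg _ Subtype.range_coe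
  obtain ⟨R, hR⟩ := T.exists_rightInverse_of_surjective hT
  have hR : ∀ x, T (R x) = x := fun x => LinearMap.congr_fun hR x
  have hSφ : ∀ (c : P →₀ F) (b : P), S c b = φ b (T c) := by
    intro c b
    induction c using Finsupp.induction_linear with
    | zero => simp
    | add c d h1 h2 => simp [h1, h2]
    | single a r =>
      simp [S, T, (hφ a).apply_comm (hφ b) a.2.ne_zero b.2.ne_zero]
  have ext_axes : ∀ {f g : A →ₗ[F] F}, (∀ b : P, f b = g b) → f = g := fun {f g} h =>
    LinearMap.ext_on hS fun b hb => h ⟨b, hb⟩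
  set B : A →ₗ[F] A →ₗ[F] F := S ∘ₗ R with hB
  have hBa : ∀ a : P, B a = φ a := fun a => ext_axes fun b => by
    rw [hB, LinearMap.comp_apply, hSφ, hR, (hφ a).apply_comm (hφ b) a.2.ne_zero b.2.ne_zero]
  have hBφ : ∀ x (b : P), B x b = φ b x := fun x b => by
    rw [hB, LinearMap.comp_apply, hSφ, hR]
  have hid : ∀ a, IsHalfAxis F a → AxisIdentities (B a) a := fun a ha => by
    have := hφ ⟨a, ha⟩
    rwa [← hBa ⟨a, ha⟩] at this
  have hcomm : ∀ x y, B x y = B y x := by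
    intro x y
    have : B = B.flip := LinearMap.ext_on hS fun a ha => LinearMap.ext fun y => by
      rw [LinearMap.flip_apply, hBφ y ⟨a, ha⟩, hBa ⟨a, ha⟩]
    conv_lhs => rw [this]
    rfl
  have hinv : ∀ a : A, IsHalfAxis F a → ∀ x y : A,
      B ((tau F a : A ≃ₗ[F] A) x) ((tau F a : A ≃ₗ[F] A) y) = B x y := by
    intro a ha x y
    have : B.compl₁₂ (((tau F a).1 : A ≃ₗ[F] A) : A →ₗ[F] A)
        (((tau F a).1 : A ≃ₗ[F] A) : A →ₗ[F] A) = B := by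
      refine LinearMap.ext_on hS fun b hb => LinearMap.ext_on hS fun c hc => ?_
      have hb : IsHalfAxis F b := hb
      have hc : IsHalfAxis F c := hc
      have h1 := (hid b hb).map (tau F a)
      have h2 := h1.apply_comm (hid _ (hc.tau (b := a))) (by simpa using hb.ne_zero)
        (by simpa using hc.ne_zero)
      simp only [LinearMap.comp_apply, LinearEquiv.coe_coe, LinearEquiv.symm_apply_apply] at h2
      rw [LinearMap.compl₁₂_apply, h2]
      exact hcomm _ _
    exact LinearMap.congr_fun₂ this x y
  refine ⟨B, hid, hcomm, fun x y z => ?_⟩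
  have : ∀ a ∈ {a : A | IsHalfAxis F a}, B (a * y) z = B y (a * z) := by
    intro a ha
    have ha : IsHalfAxis F a := ha
    have h := hinv a ha ((tau F a : A ≃ₗ[F] A) y) z
    rw [tau_tau ha, tau_apply ha (hid a ha), tau_apply ha (hid a ha)] at h
    simp only [map_add, map_sub, map_smul, LinearMap.add_apply, LinearMap.sub_apply,
      LinearMap.smul_apply, smul_eq_mul] at h
    rw [hcomm y a] at h
    linear_combination h / 4
  have hlin : (B.flip z) ∘ₗ (LinearMap.mul F A).flip y = (B y) ∘ₗ (LinearMap.mul F A).flip z :=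
    LinearMap.ext_on hS this
  exact LinearMap.congr_fun hlin x

end Form

/-! ### Interpolation along a conic -/

section Interpolation

variable {F V W : Type*} [Field F] [AddCommGroup V] [Module F V] [AddCommGroup W] [Module F W]

/-- In the coordinates `(x, y, z)` with respect to `p`, `q`, `r`, the four points `p`, `q`, `r`,
`p + s (r - q)` lie on the conic `xy + yz + (1 + s) xz = 0` in the plane `x + y + z = 1`. A
quadratic map that vanishes at them, and whose polarizations along `pq` and `qr` agree, vanishes on
the whole conic. -/
theorem quadratic_eq_zero_of_polar {N : V →ₗ[F] V →ₗ[F] W} {l : V →ₗ[F] W} {p q r : V}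
    {s x y z : F} (hp : N p p + l p = 0) (hq : N q q + l q = 0) (hr : N r r + l r = 0)
    (h₄ : N (p + s • (r - q)) (p + s • (r - q)) + l (p + s • (r - q)) = 0) (hs : s ≠ 0)
    (hC : N p q + N q p + l p = N q r + N r q + l r) (hxyz : x + y + z = 1)
    (hc : x * y + y * z + (1 + s) * (x * z) = 0) :
    N (x • p + y • q + z • r) (x • p + y • q + z • r) + l (x • p + y • q + z • r) = 0 := by
  simp only [map_add, map_sub, map_smul, LinearMap.add_apply, LinearMap.sub_apply,
    LinearMap.smul_apply] at h₄ ⊢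
  have h : s • (N p r + N r p + l p + l r) = s • ((1 + s) • (N q r + N r q + l q + l r)) := by
    linear_combination (norm := module) h₄ - hp - (s ^ 2) • hq - (s ^ 2) • hr + s • hC
  have hpr : N p r + N r p + l p + l r = (1 + s) • (N q r + N r q + l q + l r) :=
    smul_right_injective W hs h
  obtain rfl : x = 1 - y - z := by linear_combination hxyz
  linear_combination (norm := skip) (1 - y - z) ^ 2 • hp + y ^ 2 • hq + z ^ 2 • hr +
    ((1 - y - z) * z) • hpr + ((1 - y - z) * y) • hC + hc • (N q r + N r q + l q + l r)
  module

/-- The fifth point `r + s (p - q)` of the conic makes the condition on polarizations automatic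
for `s ≠ 1`. -/
theorem quadratic_polar_of_five {N : V →ₗ[F] V →ₗ[F] W} {l : V →ₗ[F] W} {p q r : V}
    {s : F} (hp : N p p + l p = 0) (hr : N r r + l r = 0)
    (h₄ : N (p + s • (r - q)) (p + s • (r - q)) + l (p + s • (r - q)) = 0)
    (h₅ : N (r + s • (p - q)) (r + s • (p - q)) + l (r + s • (p - q)) = 0)
    (hs : s ≠ 0) (hs₁ : s ≠ 1) : N p q + N q p + l p = N q r + N r q + l r := by
  simp only [map_add, map_sub, map_smul, LinearMap.add_apply, LinearMap.sub_apply,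
    LinearMap.smul_apply] at h₄ h₅
  have h : (s * (s - 1)) • (N p q + N q p + l p) = (s * (s - 1)) • (N q r + N r q + l r) := by
    linear_combination (norm := module) h₄ - h₅ + (s ^ 2 - 1) • hp - (s ^ 2 - 1) • hr
  exact smul_right_injective W (mul_ne_zero hs (sub_ne_zero.2 hs₁)) h

end Interpolation

section Conic

variable {F : Type v} [Field F] {A : Type u} [NonUnitalNonAssocCommRing A] [Module F A]
  [IsScalarTower F A A] [SMulCommClass F A A]

/-- The quadratic parts of the four identities of `AxisIdentities (B e) e`, as one bilinear map. -/
noncomputable def identityBilin (B : A →ₗ[F] A →ₗ[F] F) :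
    A →ₗ[F] A →ₗ[F] A × (A → A) × (A → A → A) × (A → A → A) :=
  LinearMap.mk₂ F (fun e f => (e * f, fun x => (2 : F) • (e * (f * x)) - B e x • f,
      fun y z => (2 : F) • ((e * y) * (f * z)) - (2 : F) • (e * ((f * y) * z)),
      fun y z => (4 : F) • ((e * y) * (f * z)) - B e y • (f * z) - B e z • (f * y) -
        B e (y * z) • f))
    (fun e e' f => by
      refine Prod.ext ?_ (Prod.ext (funext fun x => ?_) (Prod.ext (funext fun y => funext fun z =>
        ?_) (funext fun y => funext fun z => ?_))) <;>
      simp only [Prod.fst_add, Prod.snd_add, Pi.add_apply, add_mul, map_add,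
        LinearMap.add_apply] <;> module)
    (fun c e f => by
      refine Prod.ext ?_ (Prod.ext (funext fun x => ?_) (Prod.ext (funext fun y => funext fun z =>
        ?_) (funext fun y => funext fun z => ?_))) <;>
      simp only [Prod.smul_fst, Prod.smul_snd, Pi.smul_apply, smul_mul_assoc, map_smul,
        LinearMap.smul_apply, smul_eq_mul] <;> module)
    (fun e f f' => by
      refine Prod.ext ?_ (Prod.ext (funext fun x => ?_) (Prod.ext (funext fun y => funext fun z =>
        ?_) (funext fun y => funext fun z => ?_))) <;>
      simp only [Prod.fst_add, Prod.snd_add, Pi.add_apply, add_mul, mul_add] <;> module)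
    (fun c e f => by
      refine Prod.ext ?_ (Prod.ext (funext fun x => ?_) (Prod.ext (funext fun y => funext fun z =>
        ?_) (funext fun y => funext fun z => ?_))) <;>
      simp only [Prod.smul_fst, Prod.smul_snd, Pi.smul_apply, smul_mul_assoc, mul_smul_comm] <;>
      module)

variable (F A) in
/-- The linear parts of the four identities of `AxisIdentities (B e) e`. -/
noncomputable def identityLin : A →ₗ[F] A × (A → A) × (A → A → A) × (A → A → A) where
  toFun e := (-e, fun x => -(e * x), fun y z => e * (y * z) - y * (e * z),
    fun y z => e * (y * z) - y * (e * z) - z * (e * y))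
  map_add' e f := by
    refine Prod.ext ?_ (Prod.ext (funext fun x => ?_) (Prod.ext (funext fun y => funext fun z =>
      ?_) (funext fun y => funext fun z => ?_))) <;>
    simp only [Prod.fst_add, Prod.snd_add, Pi.add_apply, add_mul, mul_add] <;> abel
  map_smul' c e := by
    refine Prod.ext ?_ (Prod.ext (funext fun x => ?_) (Prod.ext (funext fun y => funext fun z =>
      ?_) (funext fun y => funext fun z => ?_))) <;>
    simp only [Prod.smul_fst, Prod.smul_snd, Pi.smul_apply, smul_mul_assoc, mul_smul_comm,
      RingHom.id_apply] <;> module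

theorem axisIdentities_iff {B : A →ₗ[F] A →ₗ[F] F} {e : A} :
    AxisIdentities (B e) e ↔ identityBilin B e e + identityLin F A e = 0 := by
  constructor
  · intro h
    refine Prod.ext ?_ (Prod.ext (funext fun x => ?_) (Prod.ext (funext fun y => funext fun z =>
      ?_) (funext fun y => funext fun z => ?_))) <;>
    simp only [identityBilin, identityLin, LinearMap.mk₂_apply, LinearMap.coe_mk, AddHom.coe_mk,
      Prod.mk_add_mk, Pi.add_apply, Prod.fst_zero, Prod.snd_zero, Pi.zero_apply]
    · linear_combination (norm := module) h.idem
    · linear_combination (norm := module) h.proj x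
    · linear_combination (norm := module) h.seress y z
    · linear_combination (norm := module) h.half y z
  · intro h
    simp only [identityBilin, identityLin, LinearMap.mk₂_apply, LinearMap.coe_mk, AddHom.coe_mk,
      Prod.mk_add_mk, Prod.mk_eq_zero, funext_iff, Pi.add_apply, Pi.zero_apply] at h
    obtain ⟨h1, h2, h3, h4⟩ := h
    refine ⟨?_, fun x => ?_, fun y z => ?_, fun y z => ?_⟩
    · linear_combination (norm := module) h1
    · linear_combination (norm := module) h2 x
    · linear_combination (norm := module) h3 y z
    · linear_combination (norm := module) h4 y z

namespace IsAxisForm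

variable [CharZero F] {B : A →ₗ[F] A →ₗ[F] F} {a b : A}

theorem apply_self (hB : IsAxisForm B) (ha : IsHalfAxis F a) : B a a = 1 :=
  (hB.identities a ha).apply_self ha.ne_zero

theorem tau_apply (hB : IsAxisForm B) (ha : IsHalfAxis F a) (x : A) :
    (tau F a : A ≃ₗ[F] A) x = x - (4 : F) • (a * x) + (4 * B a x) • a :=
  _root_.tau_apply ha (hB.identities a ha) x

theorem apply_tau (hB : IsAxisForm B) (ha : IsHalfAxis F a) (x : A) :
    B a ((tau F a : A ≃ₗ[F] A) x) = B a x := by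
  rw [hB.tau_apply ha]
  have h := hB.assoc a a x
  rw [ha.idem] at h
  simp only [map_add, map_sub, map_smul, hB.apply_self ha, ← h, smul_eq_mul]
  ring

theorem tau_eq_add (hB : IsAxisForm B) (ha : IsHalfAxis F a) (hb : IsHalfAxis F b) :
    (tau F b : A ≃ₗ[F] A) a =
      (tau F a : A ≃ₗ[F] A) b + (4 * B a b - 1) • (b - a) := by
  rw [hB.tau_apply ha, hB.tau_apply hb, hB.comm b a, mul_comm b a]
  module

theorem tau_tau_eq_add (hB : IsAxisForm B) (ha : IsHalfAxis F a) (hb : IsHalfAxis F b) :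
    (tau F a : A ≃ₗ[F] A) ((tau F b : A ≃ₗ[F] A) a) =
      b + (4 * B a b - 1) • ((tau F a : A ≃ₗ[F] A) b - a) := by
  rw [hB.tau_eq_add ha hb]
  simp only [map_add, map_smul, map_sub, tau_tau ha, tau_self ha]

/-- If all points of the conic through `τ_a(b)`, `a`, `b` satisfy the identities of an axis, then
there are infinitely many axes. -/
theorem infinite_of_conic (hB : IsAxisForm B) (ha : IsHalfAxis F a)
    (h₀ : B a b ≠ 0) (h₁ : B a b ≠ 1)
    (h : ∀ x y z : F, x + y + z = 1 → x * y + y * z + 4 * B a b * (x * z) = 0 →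
      AxisIdentities (B (x • (tau F a : A ≃ₗ[F] A) b + y • a + z • b))
        (x • (tau F a : A ≃ₗ[F] A) b + y • a + z • b)) :
    {c : A | IsHalfAxis F c}.Infinite := by
  set α := B a b with hα
  -- the rational parametrization `(1 + t : -4αt : t(1 + t))` of the conic, at integers `t ≥ 2`
  set D : ℕ → F := fun t => t ^ 2 + (2 - 4 * α) * t + 1 with hD
  set e : ℕ → A := fun t => ((1 + t) / D t) • (tau F a : A ≃ₗ[F] A) b +
    (-(4 * α * t) / D t) • a + (t * (1 + t) / D t) • b with he
  have cross : ∀ t t' : ℕ, 2 ≤ t → 2 ≤ t' → (t : F) * D t' = t' * D t → t = t' := by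
    intro t t' h2 h2' heq
    have h3 : ((t : F) - t') * (1 - t * t') = 0 := by
      simp only [hD] at heq
      linear_combination heq
    rcases mul_eq_zero.1 h3 with h4 | h4
    · exact_mod_cast sub_eq_zero.1 h4
    · have h5 : t * t' = 1 := by
        have := (sub_eq_zero.1 h4).symm
        exact_mod_cast this
      nlinarith
  have hS : {t : ℕ | 2 ≤ t ∧ D t ≠ 0}.Infinite := by
    have h2 : {t : ℕ | 2 ≤ t ∧ D t = 0}.Finite := Set.Subsingleton.finite fun t ht t' ht' =>
      cross t t' ht.1 ht'.1 (by rw [ht.2, ht'.2, mul_zero, mul_zero])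
    refine ((Set.Ici_infinite 2).sdiff h2).mono fun t ht => ⟨ht.1, fun h => ht.2 ⟨ht.1, h⟩⟩
  have hval : ∀ t, D t ≠ 0 → B a (e t) = α - 4 * α * (1 - α) * (t / D t) := by
    intro t ht
    have h2 := hB.apply_tau ha b
    simp only [he, map_add, map_smul, smul_eq_mul, h2, hB.apply_self ha, ← hα]
    field_simp
    simp only [hD]
    ring
  have hinj : Set.InjOn e {t : ℕ | 2 ≤ t ∧ D t ≠ 0} := by
    intro t ht t' ht' heq
    have h2 := congrArg (B a) heq
    rw [hval t ht.2, hval t' ht'.2] at h2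
    have h3 : (4 * α * (1 - α)) * ((t : F) / D t) = (4 * α * (1 - α)) * (t' / D t') := by
      linear_combination -h2
    have h4 := mul_left_cancel₀ (mul_ne_zero (mul_ne_zero (by norm_num : (4 : F) ≠ 0) h₀)
      (sub_ne_zero.2 h₁.symm)) h3
    rw [div_eq_div_iff ht.2 ht'.2] at h4
    exact cross t t' ht.1 ht'.1 h4
  refine ((hS.image hinj).sdiff (Set.finite_singleton 0)).mono ?_
  rintro _ ⟨⟨t, ht, rfl⟩, h0⟩
  refine (h _ _ _ ?_ ?_).isPrimitiveAxis h0
  · have := ht.2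
    field_simp
    simp only [hD]
    ring
  · have := ht.2
    field_simp
    ring

theorem infinite_of_generic (hB : IsAxisForm B) (ha : IsHalfAxis F a) (hb : IsHalfAxis F b)
    (h₀ : B a b ≠ 0) (h₁ : B a b ≠ 1) (h₂ : B a b ≠ 1 / 4) (h₃ : B a b ≠ 1 / 2) :
    {c : A | IsHalfAxis F c}.Infinite := by
  have hid : ∀ {c : A}, IsHalfAxis F c → identityBilin B c c + identityLin F A c = 0 :=
    fun hc => axisIdentities_iff.1 (hB.identities _ hc)
  have hs : 4 * B a b - 1 ≠ 0 := fun h => h₂ (by linear_combination h / 4)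
  have hs₁ : 4 * B a b - 1 ≠ 1 := fun h => h₃ (by linear_combination h / 4)
  have h4 := hid (ha.tau (b := b))
  have h5 := hid ((ha.tau (b := b)).tau (b := a))
  rw [hB.tau_eq_add ha hb] at h4
  rw [hB.tau_tau_eq_add ha hb] at h5
  refine hB.infinite_of_conic ha h₀ h₁ fun x y z hxyz hc => axisIdentities_iff.2 ?_
  exact quadratic_eq_zero_of_polar (hid hb.tau) (hid ha) (hid hb) h4 hs
    (quadratic_polar_of_five (hid hb.tau) (hid hb) h4 h5 hs hs₁) hxyz
    (by linear_combination hc)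

end IsAxisForm

end Conic

/-! ### Pairs of axes with `B a b = 0` or `B a b = 1` -/

section Degenerate

variable {F : Type v} [Field F] {A : Type u} [NonUnitalNonAssocCommRing A] [Module F A]
  [IsScalarTower F A A] [SMulCommClass F A A] [CharZero F]

/-- An axis has a finite orbit under every automorphism if there are finitely many axes. -/
theorem IsPrimitiveAxis.exists_iterate_eq (hfin : {c : A | IsHalfAxis F c}.Finite) {a : A}
    (ha : IsHalfAxis F a) (g : AlgAut F A) : ∃ n : ℕ, 0 < n ∧ (g : A ≃ₗ[F] A)^[n] a = a := by
  have hmem : ∀ n : ℕ, (g : A ≃ₗ[F] A)^[n] a ∈ {c : A | IsHalfAxis F c} := by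
    intro n
    induction n with
    | zero => exact ha
    | succ n ih =>
      rw [Function.iterate_succ_apply']
      exact IsPrimitiveAxis.map ih g
  obtain ⟨m, n, hmn, h⟩ := hfin.exists_lt_map_eq_of_forall_mem hmem
  refine ⟨n - m, by omega, ((g : A ≃ₗ[F] A).injective.iterate m) ?_⟩
  rw [← Function.iterate_add_apply, show m + (n - m) = n by omega, h]

namespace IsAxisForm

variable {B : A →ₗ[F] A →ₗ[F] F} {a b : A}

/-- If `B a b = 0` and `a b ≠ 0`, then `τ_b τ_a` translates `a` by a nonzero fixed vector. -/
theorem mul_eq_zero_of_finite (hfin : {c : A | IsHalfAxis F c}.Finite) (hB : IsAxisForm B)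
    (ha : IsHalfAxis F a) (hb : IsHalfAxis F b) (h₀ : B a b = 0) : a * b = 0 := by
  set w := b - (tau F a : A ≃ₗ[F] A) b with hw
  set g := tau F b * tau F a
  have hg : ∀ x, (g : A ≃ₗ[F] A) x = (tau F b : A ≃ₗ[F] A) ((tau F a : A ≃ₗ[F] A) x) :=
    fun x => rfl
  have h1 : (tau F b : A ≃ₗ[F] A) a = a - w := by
    rw [hB.tau_eq_add ha hb, h₀, hw]
    module
  have h2 : (tau F b : A ≃ₗ[F] A) ((tau F a : A ≃ₗ[F] A) b) = w + b := by
    have h3 := hB.tau_tau_eq_add hb ha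
    rw [hB.comm b a, h₀, h1] at h3
    rw [h3]
    module
  have hgw : (g : A ≃ₗ[F] A) w = w := by
    rw [hg, hw, map_sub, map_sub, tau_tau ha, tau_self hb, h2, add_sub_cancel_right]
  have hit : ∀ n : ℕ, (g : A ≃ₗ[F] A)^[n] a = a - (n : F) • w := by
    intro n
    induction n with
    | zero => simp
    | succ n ih =>
      rw [Function.iterate_succ_apply', ih, map_sub, map_smul, hgw, hg, tau_self ha, h1]
      push_cast
      module
  obtain ⟨n, hn, h⟩ := ha.exists_iterate_eq hfin g
  rw [hit, sub_eq_self, smul_eq_zero] at h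
  have hw0 : w = 0 := h.resolve_left (by exact_mod_cast hn.ne')
  have h3 := hB.tau_apply ha b
  rw [h₀] at h3
  have h4 : (4 : F) • (a * b) = 0 := by
    linear_combination (norm := module) hw.symm.trans hw0 + h3
  exact (smul_eq_zero.1 h4).resolve_left (by norm_num)

/-- If `B a b = 1` and `a ≠ b`, then `τ_b τ_a` is unipotent of infinite order. -/
theorem eq_of_finite (hfin : {c : A | IsHalfAxis F c}.Finite) (hB : IsAxisForm B)
    (ha : IsHalfAxis F a) (hb : IsHalfAxis F b) (h₁ : B a b = 1) : a = b := by
  set p := (tau F a : A ≃ₗ[F] A) b with hp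
  set g := tau F b * tau F a
  have hg : ∀ x, (g : A ≃ₗ[F] A) x = (tau F b : A ≃ₗ[F] A) ((tau F a : A ≃ₗ[F] A) x) :=
    fun x => rfl
  -- `g^n a = a + n d + n² r` with `d = b - p` and `r` fixed by `g`
  set d := b - p with hd
  set r := (2 : F) • (b + p - (2 : F) • a) with hr
  have ga : (g : A ≃ₗ[F] A) a = a + d + r := by
    rw [hg, tau_self ha, hB.tau_eq_add ha hb, h₁, ← hp, hd, hr]
    module
  have gp : (g : A ≃ₗ[F] A) p = b := by rw [hg, hp, tau_tau ha, tau_self hb]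
  have gb : (g : A ≃ₗ[F] A) b = a + (3 : F) • (a + d + r - b) := by
    have h3 := hB.tau_tau_eq_add hb ha
    have h4 := ga
    rw [hg, tau_self ha] at h4
    rw [hB.comm b a, h₁, h4] at h3
    rw [hg, h3]
    module
  have gr : (g : A ≃ₗ[F] A) r = r := by
    rw [hr]
    simp only [map_smul, map_add, map_sub, ga, gb, gp]
    rw [hd, hr]
    module
  have gd : (g : A ≃ₗ[F] A) d = d + (2 : F) • r := by
    rw [hd]
    simp only [map_sub, gb, gp]
    rw [hd, hr]
    module
  have hit : ∀ n : ℕ, (g : A ≃ₗ[F] A)^[n] a = a + (n : F) • d + (n ^ 2 : F) • r := by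
    intro n
    induction n with
    | zero => simp
    | succ n ih =>
      rw [Function.iterate_succ_apply', ih]
      simp only [map_add, map_smul, ga, gd, gr]
      push_cast
      module
  obtain ⟨n, hn, h⟩ := ha.exists_iterate_eq hfin g
  have h2 : (g : A ≃ₗ[F] A)^[2 * n] a = a := by
    rw [mul_comm, Function.iterate_mul]
    simp [h]
  rw [hit] at h h2
  push_cast at h2
  have hn' : (n : F) ≠ 0 := by exact_mod_cast hn.ne'
  have hr0 : r = 0 := by
    have : (2 * n ^ 2 : F) • r = 0 := by
      linear_combination (norm := module) h2 - (2 : F) • h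
    exact (smul_eq_zero.1 this).resolve_left (mul_ne_zero two_ne_zero (pow_ne_zero 2 hn'))
  have hd0 : d = 0 := by
    rw [hr0] at h
    have : (n : F) • d = 0 := by linear_combination (norm := module) h
    exact (smul_eq_zero.1 this).resolve_left hn'
  have : (4 : F) • (a - b) = 0 := by
    linear_combination (norm := module) -(2 : F) • (hd.symm.trans hd0) - hr.symm.trans hr0
  exact sub_eq_zero.1 ((smul_eq_zero.1 this).resolve_left (by norm_num))

end IsAxisForm

end Degenerate

/-! ### Pairs of axes with `B a b = 1/2` -/

section Frame

variable {F : Type v} [Field F] {A : Type u} [NonUnitalNonAssocCommRing A] [Module F A]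
  [IsScalarTower F A A] [SMulCommClass F A A]

/-- Four axes `a`, `a'`, `(a + a' ± w) / 2` with `a a' = 0` and `w ∈ A_{1/2}(a) ∩ A_{1/2}(a')`: the
configuration spanned by two axes with `B a b = 1/2`. Here `a + a'` is the identity element of the
three-dimensional subalgebra with basis `a`, `a'`, `w`. -/
structure IsAxisFrame (B : A →ₗ[F] A →ₗ[F] F) (a a' w : A) : Prop where
  form : IsAxisForm B
  left : IsHalfAxis F a
  right : IsHalfAxis F a'
  plus : IsHalfAxis F ((1 / 2 : F) • (a + a' + w))
  minus : IsHalfAxis F ((1 / 2 : F) • (a + a' - w))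
  mul_eq_zero : a * a' = 0
  left_mul : a * w = (1 / 2 : F) • w
  right_mul : a' * w = (1 / 2 : F) • w

variable [CharZero F]

namespace IsAxisFrame

variable {B : A →ₗ[F] A →ₗ[F] F} {a a' w : A}

theorem swap (h : IsAxisFrame B a a' w) : IsAxisFrame B a' a w where
  form := h.form
  left := h.right
  right := h.left
  plus := by rw [add_comm a']; exact h.plus
  minus := by rw [add_comm a']; exact h.minus
  mul_eq_zero := by rw [mul_comm, h.mul_eq_zero]
  left_mul := h.right_mul
  right_mul := h.left_mul

section

variable (h : IsAxisFrame B a a' w)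
include h

theorem ids_left : AxisIdentities (B a) a := h.form.identities _ h.left

theorem ids_right : AxisIdentities (B a') a' := h.form.identities _ h.right

theorem left_right_comm (x : A) : a * (a' * x) = a' * (a * x) :=
  h.ids_left.mul_zero_left h.mul_eq_zero x

theorem one_mul_w : (a + a') * w = w := by
  rw [add_mul, h.left_mul, h.right_mul]
  module

theorem one_mul_one : (a + a') * (a + a') = a + a' := by
  simp only [add_mul, mul_add, h.left.idem, h.right.idem, h.mul_eq_zero, mul_comm a' a]
  abel

theorem w_mul_w : w * w = a + a' := by
  have h1 := h.plus.idem
  have h2 := h.one_mul_w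
  have h3 := h.one_mul_one
  generalize a + a' = o at *
  simp only [smul_mul_assoc, mul_smul_comm, add_mul, mul_add, h2, mul_comm w o, h3] at h1
  linear_combination (norm := module) (4 : F) • h1

/-! The next four facts polarize the identities of an axis in the direction of `a + a'` and `w`;
each is the difference of the identities for the two axes `(a + a' ± w) / 2`. -/

theorem one_w_comm (x : A) : (a + a') * (w * x) = w * ((a + a') * x) := by
  have h0 : (1 / 2 : F) • (a + a' + w) * (1 / 2 : F) • (a + a' - w) = 0 := by
    have h2 := h.one_mul_w
    have h3 := h.one_mul_one
    have h4 := h.w_mul_w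
    generalize a + a' = o at *
    simp only [smul_mul_assoc, mul_smul_comm, add_mul, mul_sub, h2, mul_comm w o, h3, h4]
    module
  have h1 := (h.form.identities _ h.plus).mul_zero_left h0 x
  generalize a + a' = o at *
  simp only [smul_mul_assoc, mul_smul_comm, add_mul, mul_add, mul_sub, sub_mul] at h1
  linear_combination (norm := module) -(2 : F) • h1

theorem proj_one_w (x : A) : (2 : F) • ((a + a') * (w * x)) =
    w * x + (1 / 2 * B (a + a') x) • w + (1 / 2 * B w x) • (a + a') := by
  have h1 := (h.form.identities _ h.plus).proj x
  have h2 := (h.form.identities _ h.minus).proj x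
  have h3 := h.one_w_comm x
  generalize a + a' = o at *
  simp only [smul_mul_assoc, mul_smul_comm, add_mul, sub_mul, mul_add, mul_sub, map_add, map_sub,
    map_smul, LinearMap.add_apply, LinearMap.sub_apply, LinearMap.smul_apply, smul_eq_mul]
    at h1 h2
  linear_combination (norm := module) h1 - h2 + h3

theorem seress_one_w (y z : A) : w * (y * z) + ((a + a') * y) * (w * z) +
    (w * y) * ((a + a') * z) =
    (a + a') * ((w * y) * z) + w * (((a + a') * y) * z) + y * (w * z) := by
  have h1 := (h.form.identities _ h.plus).seress y z
  have h2 := (h.form.identities _ h.minus).seress y z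
  generalize a + a' = o at *
  simp only [smul_mul_assoc, mul_smul_comm, add_mul, sub_mul, mul_add, mul_sub] at h1 h2
  linear_combination (norm := module) h1 - h2

theorem half_one_w (y z : A) : w * (y * z) +
    (2 : F) • (((a + a') * y) * (w * z) + (w * y) * ((a + a') * z)) =
    y * (w * z) + z * (w * y) +
      (1 / 2 : F) • (B (a + a') y • (w * z) + B w y • ((a + a') * z) +
        B (a + a') z • (w * y) + B w z • ((a + a') * y) +
        B (a + a') (y * z) • w + B w (y * z) • (a + a')) := by
  have h1 := (h.form.identities _ h.plus).half y z
  have h2 := (h.form.identities _ h.minus).half y z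
  generalize a + a' = o at *
  simp only [smul_mul_assoc, mul_smul_comm, add_mul, sub_mul, mul_add, mul_sub, map_add, map_sub,
    map_smul, LinearMap.add_apply, LinearMap.sub_apply, LinearMap.smul_apply, smul_eq_mul]
    at h1 h2
  linear_combination (norm := module) h1 - h2

/-! The action of `w` on the joint eigenspaces of `a` and `a'`. -/

theorem w_mul_of_zero {z : A} (hz : a * z = 0) (hz' : a' * z = 0) : w * z = 0 := by
  have h1 := h.ids_left.mul_zero_left hz w
  have h2 := h.ids_right.mul_zero_left hz' w
  have h3 := h.one_w_comm z
  rw [h.left_mul, mul_smul_comm, mul_comm z w] at h1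
  rw [h.right_mul, mul_smul_comm, mul_comm z w] at h2
  rw [add_mul, add_mul, hz, hz', add_zero, mul_zero] at h3
  linear_combination (norm := module) h3 - h1 - h2

theorem w_mul_of_half {x : A} (hx : a * x = (1 / 2 : F) • x) (hx' : a' * x = (1 / 2 : F) • x) :
    w * x = (1 / 2 * B w x) • (a + a') := by
  have h1 := h.ids_left.mul_half_half h.left_mul hx
  have h2 := h.ids_right.mul_half_half h.right_mul hx'
  have h3 := h.one_w_comm x
  have h4 : B a (w * x) = 1 / 2 * B w x := by
    have h5 := h.form.assoc w a x
    rw [mul_comm w a, h.left_mul] at h5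
    simpa using h5.symm
  have h5 : B a' (w * x) = 1 / 2 * B w x := by
    have h5 := h.form.assoc w a' x
    rw [mul_comm w a', h.right_mul] at h5
    simpa using h5.symm
  rw [h4] at h1
  rw [h5] at h2
  rw [add_mul, add_mul, hx, hx', h1, h2, mul_add, mul_smul_comm] at h3
  linear_combination (norm := module) -h3

theorem apply_eq_zero {x y : A} (hx : a * x = (1 / 2 : F) • x) (hy : a * y = 0) : B x y = 0 := by
  have h1 := h.form.assoc a x y
  rw [hy, map_zero, hx] at h1
  simpa using h1

theorem apply_w_eq_zero {x : A} (hx : a * x = 0) : B w x = 0 :=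
  h.apply_eq_zero h.left_mul hx

theorem left_w_mul {p : A} (hp : a * p = (1 / 2 : F) • p) (hp' : a' * p = 0) :
    a * (w * p) = 0 := by
  rw [h.ids_left.mul_half_half h.left_mul hp]
  have h1 := h.form.assoc w a p
  rw [mul_comm w a, h.left_mul, map_smul, LinearMap.smul_apply,
    h.swap.apply_w_eq_zero hp', smul_zero] at h1
  rw [← h1, zero_smul]

theorem right_w_mul {p : A} (hp' : a' * p = 0) : a' * (w * p) = (1 / 2 : F) • (w * p) := by
  rw [mul_comm w p, h.ids_right.mul_zero_left hp', h.right_mul, mul_smul_comm]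

/-- Every property closed under linear combinations holds everywhere if it holds on the joint
eigenspaces of `a` and `a'`. -/
theorem induction {P : A → Prop} (hadd : ∀ x y, P x → P y → P (x + y))
    (hsmul : ∀ (c : F) x, P x → P (c • x)) (hleft : P a) (hright : P a')
    (hhalf : ∀ x, a * x = (1 / 2 : F) • x → a' * x = (1 / 2 : F) • x → P x)
    (hzero : ∀ x, a * x = 0 → a' * x = 0 → P x)
    (hl : ∀ x, a * x = (1 / 2 : F) • x → a' * x = 0 → P x)
    (hr : ∀ x, a * x = 0 → a' * x = (1 / 2 : F) • x → P x) (x : A) : P x := by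
  obtain ⟨ξ, x₀, x₁, h₀, h₁, rfl⟩ := h.left.exists_decomp x
  obtain ⟨η, z, m, hz, hm, rfl⟩ := h.right.exists_decomp x₀
  obtain ⟨ζ, p, q, hp, hq, rfl⟩ := h.right.exists_decomp x₁
  have haa := h.mul_eq_zero
  have hζ : ζ = 0 := by
    have h5 := h.form.assoc a a' (ζ • a' + p + q)
    rw [haa, h₁] at h5
    have h6 : B a' (ζ • a' + p + q) = ζ := by
      simp [h.form.apply_self h.right, h.ids_right.apply_eq_zero_of_mul_eq_zero h.right.ne_zero hp,
        h.ids_right.apply_eq_zero_of_half h.right.ne_zero hq]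
    rw [map_zero, LinearMap.zero_apply, map_smul, h6] at h5
    simpa using h5.symm
  subst hζ
  have am : a * m = 0 := by
    have := h.left_right_comm (η • a' + z + m)
    rw [h₀] at this
    simp only [mul_add, mul_smul_comm, h.right.idem, hz, hm, haa, mul_zero, smul_zero, zero_add]
      at this
    exact (smul_eq_zero.1 this).resolve_left (by norm_num)
  have az : a * z = 0 := by
    simpa [mul_add, mul_smul_comm, haa, am] using h₀
  have aq : a * q = (1 / 2 : F) • q := by
    have := h.left_right_comm ((0 : F) • a' + p + q)
    rw [h₁] at this
    simp only [mul_add, mul_smul_comm, hp, hq, zero_smul, zero_add] at this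
    linear_combination (norm := module) (2 : F) • this
  have ap : a * p = (1 / 2 : F) • p := by
    simp only [mul_add, aq, zero_smul, zero_add] at h₁
    linear_combination (norm := module) h₁
  exact hadd _ _ (hadd _ _ (hsmul _ _ hleft) (hadd _ _ (hadd _ _ (hsmul _ _ hright)
    (hzero _ az hz)) (hr _ am hm))) (hadd _ _ (hadd _ _ (hsmul _ _ hright) (hl _ ap hp))
    (hhalf _ aq hq))

end

end IsAxisFrame

end Frame

section Polarization

variable {F : Type v} [Field F] {A : Type u} [NonUnitalNonAssocCommRing A] [Module F A]
  [IsScalarTower F A A] [SMulCommClass F A A] [CharZero F]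

namespace IsAxisFrame

variable {B : A →ₗ[F] A →ₗ[F] F} {a a' w : A} (h : IsAxisFrame B a a' w)
include h

theorem left_apply_half {x : A} (hx : a * x = (1 / 2 : F) • x) : B a x = 0 :=
  h.ids_left.apply_eq_zero_of_half h.left.ne_zero hx

theorem left_apply_zero {x : A} (hx : a * x = 0) : B a x = 0 :=
  h.ids_left.apply_eq_zero_of_mul_eq_zero h.left.ne_zero hx

/-! Products of elements of the joint eigenspaces, for the eigenvalue pairs `(1/2, 1/2)`, `(1/2, 0)`
and `(0, 1/2)`. -/

theorem w_mul_half_mul {x p : A} (hx : a * x = (1 / 2 : F) • x) (hx' : a' * x = (1 / 2 : F) • x)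
    (hp : a * p = (1 / 2 : F) • p) (hp' : a' * p = 0) :
    w * (x * p) + x * (w * p) = (1 / 4 * B w x) • p := by
  have h1 := h.half_one_w x p
  have hwx := h.w_mul_of_half hx hx'
  have e1 : (a + a') * x = x := by rw [add_mul, hx, hx']; module
  have e2 : (a + a') * p = (1 / 2 : F) • p := by rw [add_mul, hp, hp', add_zero]
  have e3 : B (a + a') x = 0 := by
    rw [map_add, LinearMap.add_apply, h.left_apply_half hx, h.swap.left_apply_half hx', add_zero]
  have e4 : B (a + a') p = 0 := by
    rw [map_add, LinearMap.add_apply, h.left_apply_half hp, h.swap.left_apply_zero hp', add_zero]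
  have e5 : B w p = 0 := h.swap.apply_w_eq_zero hp'
  have e6 : B (a + a') (x * p) = 0 := by
    have h2 := h.form.assoc x (a + a') p
    rw [mul_comm x, e1] at h2
    have h3 := h.form.assoc a' x p
    rw [hp', hx', map_zero] at h3
    rw [← h2]
    simpa using h3
  have e7 : B w (x * p) = 0 := by
    rw [← h.form.assoc x w p, mul_comm x w, hwx, map_smul, LinearMap.smul_apply, e4, smul_zero]
  rw [e1, e2, e3, e4, e5, e6, e7, hwx] at h1
  simp only [smul_mul_assoc, mul_smul_comm, mul_comm p (a + a'), e2] at h1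
  linear_combination (norm := module) h1

theorem w_mul_mul {y z : A} (hy : (a + a') * y = (1 / 2 : F) • y)
    (hz : (a + a') * z = (1 / 2 : F) • z) :
    w * (y * z) = (2 : F) • ((a + a') * ((w * y) * z)) + y * (w * z) - (w * y) * z := by
  have h1 := h.seress_one_w y z
  rw [hy, hz] at h1
  simp only [smul_mul_assoc, mul_smul_comm] at h1
  linear_combination (norm := module) (2 : F) • h1

theorem mul_w_mul_left {y z : A} (hy : a * y = (1 / 2 : F) • y) (hy' : a' * y = 0)
    (hz : a * z = (1 / 2 : F) • z) (hz' : a' * z = 0) :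
    y * (w * z) + (w * y) * z = (1 / 4 * B y z) • w := by
  have h1 := h.w_mul_mul (y := y) (z := z) (by rw [add_mul, hy, hy', add_zero])
    (by rw [add_mul, hz, hz', add_zero])
  have h2 : a * ((w * y) * z) = (1 / 2 : F) • ((w * y) * z) := by
    rw [h.ids_left.mul_zero_left (h.left_w_mul hy hy'), hz, mul_smul_comm]
  have h3 : a' * ((w * y) * z) = (1 / 2 : F) • ((w * y) * z) := by
    rw [mul_comm (w * y), h.ids_right.mul_zero_left hz', h.right_w_mul hy', mul_smul_comm]
  have h4 : a * (y * z) = (1 / 2 * B y z) • a := by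
    have h5 := h.form.assoc y a z
    rw [mul_comm y a, hy, map_smul, LinearMap.smul_apply, smul_eq_mul] at h5
    rw [h.ids_left.mul_half_half hy hz, h5]
  -- `y * z` is a multiple of `a` plus an element annihilated by `a` and `a'`, hence by `w`
  have h5 : w * (y * z - (1 / 2 * B y z) • a) = 0 := by
    apply h.w_mul_of_zero
    · rw [mul_sub, h4, mul_smul_comm, h.left.idem, sub_self]
    · rw [mul_sub, h.ids_right.mul_zero_left hy', hz', mul_smul_comm, mul_comm a',
        h.mul_eq_zero]
      simp
  rw [mul_sub, mul_smul_comm, mul_comm w a, h.left_mul] at h5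
  rw [add_mul, h2, h3] at h1
  linear_combination (norm := module) h5 - h1

theorem mul_w_mul_right {y z : A} (hy : a * y = (1 / 2 : F) • y) (hy' : a' * y = 0)
    (hz : a * z = 0) (hz' : a' * z = (1 / 2 : F) • z) :
    y * (w * z) - (w * y) * z = (1 / 2 * B (w * y) z) • (a - a') := by
  have h1 := h.w_mul_mul (y := y) (z := z) (by rw [add_mul, hy, hy', add_zero])
    (by rw [add_mul, hz, hz', zero_add])
  have h2 : a * ((w * y) * z) = 0 := by
    rw [h.ids_left.mul_zero_left (h.left_w_mul hy hy'), hz, mul_zero]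
  have h3 : a' * ((w * y) * z) = (1 / 2 * B (w * y) z) • a' := by
    have h5 := h.form.assoc (w * y) a' z
    rw [mul_comm (w * y) a', h.right_w_mul hy', map_smul, LinearMap.smul_apply, smul_eq_mul] at h5
    rw [h.ids_right.mul_half_half (h.right_w_mul hy') hz', h5]
  have h4 : w * (y * z) = (1 / 2 * B w (y * z)) • (a + a') := by
    apply h.w_mul_of_half
    · rw [mul_comm y, h.ids_left.mul_zero_left hz, hy, mul_smul_comm]
    · rw [h.ids_right.mul_zero_left hy', hz', mul_smul_comm]
  rw [← h.form.assoc y w z, mul_comm y w] at h4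
  rw [add_mul, h2, h3, h4] at h1
  linear_combination (norm := module) -h1

/-! The polarizations of the identities of an axis in the directions `a - a'` and `w` hold. -/

theorem sub_mul_w : (a - a') * w = 0 := by
  rw [sub_mul, h.left_mul, h.right_mul, sub_self]

theorem proj_sub_w (x : A) : (2 : F) • ((a - a') * (w * x)) + (2 : F) • (w * ((a - a') * x)) =
    B (a - a') x • w + B w x • (a - a') := by
  have haa := h.mul_eq_zero
  have haa' := h.swap.mul_eq_zero
  induction x using h.induction with
  | hadd x y hx hy =>
    simp only [mul_add, map_add]
    linear_combination (norm := module) hx + hy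
  | hsmul c x hx =>
    simp only [mul_smul_comm, map_smul, smul_eq_mul]
    linear_combination (norm := module) c • hx
  | hleft =>
    have e1 : B w a = 0 := by rw [h.form.comm]; exact h.left_apply_half h.left_mul
    simp only [map_sub, LinearMap.sub_apply, h.form.apply_self h.left, h.swap.left_apply_zero haa',
      mul_comm w a, h.left_mul, sub_mul, mul_sub, haa', h.left.idem, mul_smul_comm, h.right_mul,
      mul_zero, e1]
    module
  | hright =>
    have e1 : B w a' = 0 := by rw [h.form.comm]; exact h.swap.left_apply_half h.right_mul
    simp only [map_sub, LinearMap.sub_apply, h.form.apply_self h.right, h.left_apply_zero haa,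
      mul_comm w a', h.left_mul, sub_mul, mul_sub, haa, h.right.idem, mul_smul_comm, h.right_mul,
      mul_zero, e1]
    module
  | hhalf x hx hx' =>
    simp only [map_sub, LinearMap.sub_apply, h.left_apply_half hx, h.swap.left_apply_half hx',
      h.w_mul_of_half hx hx', sub_mul, mul_add, mul_smul_comm, hx, hx', h.left.idem, h.right.idem,
      haa, haa', sub_self, mul_zero]
    module
  | hzero x hx hx' =>
    simp [h.left_apply_zero hx, h.swap.left_apply_zero hx', h.w_mul_of_zero hx hx', sub_mul, hx,
      hx', h.apply_w_eq_zero hx]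
  | hl x hx hx' =>
    simp only [map_sub, LinearMap.sub_apply, h.left_apply_half hx, h.swap.left_apply_zero hx',
      sub_mul, hx, hx', mul_smul_comm, h.left_w_mul hx hx', h.right_w_mul hx',
      h.swap.apply_w_eq_zero hx', mul_zero, mul_sub]
    module
  | hr x hx hx' =>
    simp only [map_sub, LinearMap.sub_apply, h.left_apply_zero hx, h.swap.left_apply_half hx',
      sub_mul, hx, hx', mul_smul_comm, h.swap.left_w_mul hx' hx, h.swap.right_w_mul hx,
      h.apply_w_eq_zero hx, mul_zero, mul_sub]
    module

theorem seress_sub_w_left {y : A} (hy : a * y = (1 / 2 : F) • y) (hy' : a' * y = 0) (z : A) :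
    ((a - a') * y) * (w * z) + (w * y) * ((a - a') * z) =
      (a - a') * ((w * y) * z) + w * (((a - a') * y) * z) := by
  have haa := h.mul_eq_zero
  have haa' := h.swap.mul_eq_zero
  have hv := h.left_w_mul hy hy'
  have hv' := h.right_w_mul hy'
  have hu : (a - a') * y = (1 / 2 : F) • y := by rw [sub_mul, hy, hy', sub_zero]
  rw [hu]
  induction z using h.induction with
  | hadd x y hx hy =>
    simp only [mul_add]
    linear_combination (norm := module) hx + hy
  | hsmul c x hx =>
    simp only [mul_smul_comm]
    linear_combination (norm := module) c • hx
  | hleft =>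
    simp only [smul_mul_assoc, mul_smul_comm, mul_sub, mul_comm _ a, h.left_mul, hv, hy,
      h.left.idem, haa, mul_zero, mul_comm y w]
    module
  | hright =>
    simp only [smul_mul_assoc, mul_smul_comm, sub_mul, mul_sub, mul_comm _ a', h.right_mul, hv',
      hv, hy', h.right.idem, haa', mul_zero, mul_comm y w]
    module
  | hhalf z hz hz' =>
    have h1 := h.w_mul_half_mul hz hz' hy hy'
    have h2 : a * ((w * y) * z) = (1 / 2 : F) • ((w * y) * z) := by
      rw [h.ids_left.mul_zero_left hv, hz, mul_smul_comm]
    have h3 : a' * ((w * y) * z) = 0 := by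
      have h4 := h.form.assoc z a' (w * y)
      have h5 := h.form.assoc a z (w * y)
      rw [hz, hv, map_zero] at h5
      have h6 : B z (w * y) = 0 := by simpa using h5
      rw [mul_comm z a', hz', map_smul, LinearMap.smul_apply, h6, smul_zero] at h4
      rw [mul_comm (w * y), h.ids_right.mul_half_half hz' hv', ← h4, zero_smul]
    rw [h.w_mul_of_half hz hz', sub_mul, sub_mul, hz, hz', h2, h3]
    simp only [smul_mul_assoc, mul_smul_comm, sub_self, mul_zero, mul_add, mul_comm y a,
      mul_comm y a', hy, hy', mul_comm y z, mul_comm (w * y) z]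
    linear_combination (norm := module) -(1 / 2 : F) • h1
  | hzero z hz hz' =>
    have h1 := h.w_mul_of_zero hz hz'
    have h2 := h.seress_one_w z y
    have h3 : a * ((w * y) * z) = 0 := by
      rw [h.ids_left.mul_zero_left hv, hz, mul_zero]
    have h4 : a' * ((w * y) * z) = (1 / 2 : F) • ((w * y) * z) := by
      rw [mul_comm (w * y), h.ids_right.mul_zero_left hz', hv', mul_smul_comm]
    rw [h1, add_mul a a' z, hz, hz'] at h2
    simp only [add_zero, zero_mul, mul_zero, zero_add] at h2
    rw [h1, sub_mul, sub_mul, hz, hz', h3, h4, smul_mul_assoc, smul_mul_assoc, mul_smul_comm _ w,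
      mul_comm y z, h2, mul_comm z]
    simp
  | hl z hz hz' =>
    have h2 := h.w_mul_mul (y := y) (z := z) (by rw [add_mul, hy, hy', add_zero])
      (by rw [add_mul, hz, hz', add_zero])
    have h3 : a * ((w * y) * z) = (1 / 2 : F) • ((w * y) * z) := by
      rw [h.ids_left.mul_zero_left hv, hz, mul_smul_comm]
    have h4 : a' * ((w * y) * z) = (1 / 2 : F) • ((w * y) * z) := by
      rw [mul_comm (w * y), h.ids_right.mul_zero_left hz', hv', mul_smul_comm]
    rw [add_mul, h3, h4] at h2
    rw [sub_mul, sub_mul, hz, hz', h3, h4, smul_mul_assoc, smul_mul_assoc, mul_smul_comm, h2,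
      sub_zero, mul_smul_comm]
    module
  | hr z hz hz' =>
    have h2 := h.w_mul_mul (y := y) (z := z) (by rw [add_mul, hy, hy', add_zero])
      (by rw [add_mul, hz, hz', zero_add])
    have h3 : a * ((w * y) * z) = 0 := by
      rw [h.ids_left.mul_zero_left hv, hz, mul_zero]
    rw [add_mul, h3] at h2
    rw [sub_mul, sub_mul, hz, hz', h3, smul_mul_assoc, smul_mul_assoc, mul_smul_comm _ w, h2,
      zero_sub, mul_neg, mul_smul_comm]
    module

theorem seress_sub_w (y z : A) : ((a - a') * y) * (w * z) + (w * y) * ((a - a') * z) =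
    (a - a') * ((w * y) * z) + w * (((a - a') * y) * z) := by
  have haa := h.mul_eq_zero
  have haa' := h.swap.mul_eq_zero
  induction y using h.induction with
  | hadd x y hx hy =>
    simp only [mul_add, add_mul]
    linear_combination (norm := module) hx + hy
  | hsmul c x hx =>
    simp only [mul_smul_comm, smul_mul_assoc]
    linear_combination (norm := module) c • hx
  | hleft =>
    have h1 := h.one_w_comm z
    simp only [add_mul, mul_add] at h1
    simp only [mul_comm w a, h.left_mul, sub_mul, h.left.idem, haa', smul_mul_assoc, sub_zero,
      mul_smul_comm, mul_sub]
    linear_combination (norm := module) (1 / 2 : F) • h1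
  | hright =>
    have h1 := h.one_w_comm z
    simp only [add_mul, mul_add] at h1
    simp only [mul_comm w a', h.right_mul, sub_mul, h.right.idem, haa, smul_mul_assoc, zero_sub,
      mul_smul_comm, mul_sub, neg_mul, mul_neg]
    linear_combination (norm := module) -(1 / 2 : F) • h1
  | hhalf x hx hx' =>
    have h1 := h.left_right_comm z
    simp only [h.w_mul_of_half hx hx', sub_mul, add_mul, hx, hx', sub_self, zero_mul, mul_zero,
      smul_mul_assoc, mul_smul_comm, mul_add, mul_sub]
    linear_combination (norm := module) -(B w x) • h1
  | hzero x hx hx' =>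
    simp [h.w_mul_of_zero hx hx', sub_mul, hx, hx']
  | hl x hx hx' => exact h.seress_sub_w_left hx hx' z
  | hr x hx hx' =>
    have h1 := h.swap.seress_sub_w_left hx' hx z
    simp only [← neg_sub a a', neg_mul, mul_neg] at h1
    linear_combination (norm := module) -h1

theorem proj_one_sub (x : A) : (2 : F) • ((a + a') * ((a - a') * x)) =
    (a - a') * x + (1 / 2 * B (a + a') x) • (a - a') + (1 / 2 * B (a - a') x) • (a + a') := by
  have h1 := h.ids_left.proj x
  have h2 := h.ids_right.proj x
  have h3 := h.left_right_comm x
  simp only [add_mul, sub_mul, mul_sub, map_add, map_sub, LinearMap.add_apply, LinearMap.sub_apply]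
  linear_combination (norm := module) h1 - h2 - (2 : F) • h3

theorem half_sub_w (y z : A) :
    (4 : F) • (((a - a') * y) * (w * z) + (w * y) * ((a - a') * z)) =
      B (a - a') y • (w * z) + B (a - a') z • (w * y) + B (a - a') (y * z) • w +
      B w y • ((a - a') * z) + B w z • ((a - a') * y) + B w (y * z) • (a - a') := by
  have haa := h.mul_eq_zero
  have haa' := h.swap.mul_eq_zero
  set P : A → A → Prop := fun y z =>
    (4 : F) • (((a - a') * y) * (w * z) + (w * y) * ((a - a') * z)) =
      B (a - a') y • (w * z) + B (a - a') z • (w * y) + B (a - a') (y * z) • w +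
      B w y • ((a - a') * z) + B w z • ((a - a') * y) + B w (y * z) • (a - a') with hP
  have symm : ∀ {y z}, P y z → P z y := by
    intro y z hyz
    simp only [hP, mul_comm z y, mul_comm ((a - a') * z), mul_comm (w * z)] at hyz ⊢
    linear_combination (norm := module) hyz
  have hadd : ∀ z x y, P x z → P y z → P (x + y) z := by
    intro z x y hx hy
    simp only [hP, mul_add, add_mul, map_add] at hx hy ⊢
    linear_combination (norm := module) hx + hy
  have hsmul : ∀ z (c : F) x, P x z → P (c • x) z := by
    intro z c x hx
    simp only [hP, mul_smul_comm, smul_mul_assoc, map_smul, smul_eq_mul] at hx ⊢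
    linear_combination (norm := module) c • hx
  have hwz : ∀ z, B w (a * z) = 1 / 2 * B w z ∧ B w (a' * z) = 1 / 2 * B w z := by
    intro z
    rw [← h.form.assoc a w z, ← h.form.assoc a' w z, h.left_mul, h.right_mul]
    simp
  have hleft : ∀ z, P a z := by
    intro z
    have h1 := h.proj_sub_w z
    have h2 := h.proj_one_w z
    have e1 : B w a = 0 := by rw [h.form.comm]; exact h.left_apply_half h.left_mul
    have e2 : B a (a * z) = B a z := by rw [← h.form.assoc a a z, h.left.idem]
    have e3 : B a' (a * z) = 0 := by rw [← h.form.assoc a a' z, haa, map_zero]; rfl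
    simp only [hP, map_sub, LinearMap.sub_apply, map_add, LinearMap.add_apply, e1, e2, e3,
      (hwz z).1, h.form.apply_self h.left, h.swap.left_apply_zero haa', mul_comm w a, h.left_mul,
      sub_mul, add_mul, mul_sub, haa', h.left.idem, smul_mul_assoc, zero_mul] at h1 h2 ⊢
    linear_combination (norm := module) h1 + h2
  have hright : ∀ z, P a' z := by
    intro z
    have h1 := h.proj_sub_w z
    have h2 := h.proj_one_w z
    have e1 : B w a' = 0 := by rw [h.form.comm]; exact h.swap.left_apply_half h.right_mul
    have e2 : B a' (a' * z) = B a' z := by rw [← h.form.assoc a' a' z, h.right.idem]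
    have e3 : B a (a' * z) = 0 := by rw [← h.form.assoc a' a z, haa', map_zero]; rfl
    simp only [hP, map_sub, LinearMap.sub_apply, map_add, LinearMap.add_apply, e1, e2, e3,
      (hwz z).2, h.form.apply_self h.right, h.left_apply_zero haa, mul_comm w a', h.right_mul,
      sub_mul, add_mul, mul_sub, haa, h.right.idem, smul_mul_assoc, zero_mul] at h1 h2 ⊢
    linear_combination (norm := module) h1 - h2
  have hhalf : ∀ y, a * y = (1 / 2 : F) • y → a' * y = (1 / 2 : F) • y → ∀ z, P y z := by
    intro y hy hy' z
    have h1 := h.proj_one_sub z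
    have e1 : (a - a') * y = 0 := by rw [sub_mul, hy, hy', sub_self]
    have e2 : B (a - a') y = 0 := by
      rw [map_sub, LinearMap.sub_apply, h.left_apply_half hy, h.swap.left_apply_half hy', sub_zero]
    have e3 : B (a - a') (y * z) = 0 := by
      rw [← h.form.assoc y _ z, mul_comm y, e1, map_zero]; rfl
    have e4 : B w (y * z) = 1 / 2 * B w y * B (a + a') z := by
      rw [← h.form.assoc y w z, mul_comm y, h.w_mul_of_half hy hy', map_smul,
        LinearMap.smul_apply, smul_eq_mul]
    simp only [hP, e1, e2, e3, e4, h.w_mul_of_half hy hy', zero_mul, smul_mul_assoc]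
    linear_combination (norm := module) (B w y) • h1
  have hzero : ∀ y, a * y = 0 → a' * y = 0 → ∀ z, P y z := by
    intro y hy hy' z
    have e1 : (a - a') * y = 0 := by rw [sub_mul, hy, hy', sub_self]
    have e2 : B (a - a') y = 0 := by
      rw [map_sub, LinearMap.sub_apply, h.left_apply_zero hy, h.swap.left_apply_zero hy', sub_zero]
    have e3 : B (a - a') (y * z) = 0 := by
      rw [← h.form.assoc y _ z, mul_comm y, e1, map_zero]; rfl
    have e4 : B w (y * z) = 0 := by
      rw [← h.form.assoc y w z, mul_comm y, h.w_mul_of_zero hy hy', map_zero]; rfl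
    simp only [hP, e1, e2, e3, e4, h.w_mul_of_zero hy hy', h.apply_w_eq_zero hy, zero_mul,
      zero_smul, smul_zero, add_zero]
  have hu : ∀ {y}, a * y = (1 / 2 : F) • y → a' * y = 0 →
      (a - a') * y = (1 / 2 : F) • y ∧ B (a - a') y = 0 ∧ B w y = 0 := by
    intro y hy hy'
    rw [sub_mul, map_sub, LinearMap.sub_apply, h.left_apply_half hy, h.swap.left_apply_zero hy', hy,
      hy', sub_zero]
    exact ⟨rfl, sub_zero _, h.swap.apply_w_eq_zero hy'⟩
  have hu' : ∀ {y}, a * y = 0 → a' * y = (1 / 2 : F) • y →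
      (a - a') * y = -(1 / 2 : F) • y ∧ B (a - a') y = 0 ∧ B w y = 0 := by
    intro y hy hy'
    rw [sub_mul, map_sub, LinearMap.sub_apply, h.left_apply_zero hy, h.swap.left_apply_half hy', hy,
      hy', zero_sub, neg_smul]
    exact ⟨rfl, sub_zero _, h.apply_w_eq_zero hy⟩
  -- on `A_{1/2}(a + a')` only the terms with `B (a - a') (y * z)` and `B w (y * z)` survive
  have hlr : ∀ y z, a * y = (1 / 2 : F) • y → a' * y = 0 → a * z = 0 →
      a' * z = (1 / 2 : F) • z → P y z := by
    intro y z hy hy' hz hz'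
    obtain ⟨e1, e2, e3⟩ := hu hy hy'
    obtain ⟨f1, f2, f3⟩ := hu' hz hz'
    have h1 := h.mul_w_mul_right hy hy' hz hz'
    have g1 : B (a - a') (y * z) = 0 := by
      rw [← h.form.assoc y _ z, mul_comm y, e1, map_smul, LinearMap.smul_apply,
        h.apply_eq_zero hy hz, smul_zero]
    have g2 : B w (y * z) = B (w * y) z := by rw [← h.form.assoc y w z, mul_comm y]
    simp only [hP, e1, e2, e3, f1, f2, f3, g1, g2, smul_mul_assoc, mul_smul_comm]
    linear_combination (norm := module) (2 : F) • h1
  have hll : ∀ y z, a * y = (1 / 2 : F) • y → a' * y = 0 → a * z = (1 / 2 : F) • z →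
      a' * z = 0 → P y z := by
    intro y z hy hy' hz hz'
    obtain ⟨e1, e2, e3⟩ := hu hy hy'
    obtain ⟨f1, f2, f3⟩ := hu hz hz'
    have h1 := h.mul_w_mul_left hy hy' hz hz'
    have g1 : B (a - a') (y * z) = 1 / 2 * B y z := by
      rw [← h.form.assoc y _ z, mul_comm y, e1, map_smul, LinearMap.smul_apply, smul_eq_mul]
    have g2 : B w (y * z) = 0 := by
      rw [← h.form.assoc y w z, mul_comm y]
      exact h.swap.apply_eq_zero (h.right_w_mul hy') hz'
    simp only [hP, e1, e2, e3, f1, f2, f3, g1, g2, smul_mul_assoc, mul_smul_comm]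
    linear_combination (norm := module) (2 : F) • h1
  have hrr : ∀ y z, a * y = 0 → a' * y = (1 / 2 : F) • y → a * z = 0 →
      a' * z = (1 / 2 : F) • z → P y z := by
    intro y z hy hy' hz hz'
    obtain ⟨e1, e2, e3⟩ := hu' hy hy'
    obtain ⟨f1, f2, f3⟩ := hu' hz hz'
    have h1 := h.swap.mul_w_mul_left hy' hy hz' hz
    have g1 : B (a - a') (y * z) = -(1 / 2) * B y z := by
      rw [← h.form.assoc y _ z, mul_comm y, e1, map_smul, LinearMap.smul_apply, smul_eq_mul]
    have g2 : B w (y * z) = 0 := by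
      rw [← h.form.assoc y w z, mul_comm y]
      exact h.apply_eq_zero (h.swap.right_w_mul hy) hz
    simp only [hP, e1, e2, e3, f1, f2, f3, g1, g2, smul_mul_assoc, mul_smul_comm]
    linear_combination (norm := module) -(2 : F) • h1
  refine h.induction (P := fun y => P y z) (hadd z) (hsmul z) (hleft z) (hright z)
    (fun y hy hy' => hhalf y hy hy' z) (fun y hy hy' => hzero y hy hy' z) (fun y hy hy' => ?_)
    (fun y hy hy' => ?_) y <;> refine symm ?_
  · exact h.induction (P := fun z => P z y) (hadd y) (hsmul y) (hleft y) (hright y)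
      (fun z hz hz' => hhalf z hz hz' y) (fun z hz hz' => hzero z hz hz' y)
      (fun z hz hz' => hll z y hz hz' hy hy') (fun z hz hz' => symm (hlr y z hy hy' hz hz')) z
  · exact h.induction (P := fun z => P z y) (hadd y) (hsmul y) (hleft y) (hright y)
      (fun z hz hz' => hhalf z hz hz' y) (fun z hz hz' => hzero z hz hz' y)
      (fun z hz hz' => hlr z y hz hz' hy hy') (fun z hz hz' => hrr z y hz hz' hy hy') z

theorem identityBilin_add_eq_zero :
    identityBilin B (a - a') w + identityBilin B w (a - a') = 0 := by
  have h0 := h.sub_mul_w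
  refine Prod.ext ?_ (Prod.ext (funext fun x => ?_) (Prod.ext (funext fun y => funext fun z =>
    ?_) (funext fun y => funext fun z => ?_))) <;>
  simp only [identityBilin, LinearMap.mk₂_apply, Prod.mk_add_mk, Pi.add_apply, Prod.fst_zero,
    Prod.snd_zero, Pi.zero_apply]
  · rw [mul_comm w, h0, add_zero]
  · linear_combination (norm := module) h.proj_sub_w x
  · linear_combination (norm := module) (2 : F) • h.seress_sub_w y z
  · linear_combination (norm := module) h.half_sub_w y z

end IsAxisFrame

end Polarization

/-! ### Pairs of axes when there are finitely many axes -/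

section Pairs

variable {F : Type v} [Field F] {A : Type u} [NonUnitalNonAssocCommRing A] [Module F A]
  [IsScalarTower F A A] [SMulCommClass F A A] [CharZero F]

namespace IsAxisForm

variable {B : A →ₗ[F] A →ₗ[F] F} {a b : A}

theorem isAxisFrame (hB : IsAxisForm B) (ha : IsHalfAxis F a) (hb : IsHalfAxis F b)
    (h : B a b = 1 / 2) :
    IsAxisFrame B a ((tau F b : A ≃ₗ[F] A) a) (b - (tau F a : A ≃ₗ[F] A) b) := by
  have e1 : (tau F a : A ≃ₗ[F] A) b = b - (4 : F) • (a * b) + (2 : F) • a := by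
    rw [hB.tau_apply ha, h]
    module
  have e2 : (tau F b : A ≃ₗ[F] A) a = a - (4 : F) • (a * b) + (2 : F) • b := by
    rw [hB.tau_apply hb, hB.comm, h, mul_comm b a]
    module
  have p1 := (hB.identities a ha).proj b
  have p2 := (hB.identities b hb).proj a
  rw [h] at p1
  rw [hB.comm, h] at p2
  have i1 : a * a = a := ha.idem
  have i2 : b * b = b := hb.idem
  have l1 : a * (b - (tau F a : A ≃ₗ[F] A) b) =
      (1 / 2 : F) • (b - (tau F a : A ≃ₗ[F] A) b) := by
    rw [e1]
    simp only [mul_sub, mul_add, mul_smul_comm, i1]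
    linear_combination (norm := module) (2 : F) • p1
  have l2 : b * ((tau F a : A ≃ₗ[F] A) b) = 0 := by
    rw [e1]
    simp only [mul_sub, mul_add, mul_smul_comm, i2, mul_comm a b]
    linear_combination (norm := module) -(2 : F) • p2
  have sum : a + (tau F b : A ≃ₗ[F] A) a = b + (tau F a : A ≃ₗ[F] A) b := by
    rw [e1, e2]
    module
  have i3 := (hb.tau (b := a)).idem
  refine ⟨hB, ha, ha.tau, ?_, ?_, ?_, l1, ?_⟩
  · rw [sum, show (1 / 2 : F) • (b + (tau F a : A ≃ₗ[F] A) b + (b - (tau F a : A ≃ₗ[F] A) b)) = b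
      by module]
    exact hb
  · rw [sum, show (1 / 2 : F) • (b + (tau F a : A ≃ₗ[F] A) b - (b - (tau F a : A ≃ₗ[F] A) b)) =
      (tau F a : A ≃ₗ[F] A) b by module]
    exact hb.tau
  · rw [e2]
    simp only [mul_sub, mul_add, mul_smul_comm, i1]
    linear_combination (norm := module) -(2 : F) • p1
  · rw [eq_sub_of_add_eq' sum, sub_mul, l1]
    generalize (tau F a : A ≃ₗ[F] A) b = b' at *
    simp only [add_mul, mul_sub, i2, i3, l2, mul_comm b' b]
    module

theorem infinite_of_half (hB : IsAxisForm B) (ha : IsHalfAxis F a) (hb : IsHalfAxis F b)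
    (h : B a b = 1 / 2) : {c : A | IsHalfAxis F c}.Infinite := by
  have hid : ∀ {c : A}, IsHalfAxis F c → identityBilin B c c + identityLin F A c = 0 :=
    fun hc => axisIdentities_iff.1 (hB.identities _ hc)
  have hf := (hB.isAxisFrame ha hb h).identityBilin_add_eq_zero
  have h4 := hid (ha.tau (b := b))
  have hs : 4 * B a b - 1 = 1 := by rw [h]; norm_num
  rw [hB.tau_eq_add ha hb, hs] at h4 hf
  have hp := hid (hb.tau (b := a))
  have hr := hid hb
  refine hB.infinite_of_conic ha (by rw [h]; norm_num) (by rw [h]; norm_num)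
    fun x y z hxyz hc => axisIdentities_iff.2 ?_
  refine quadratic_eq_zero_of_polar hp (hid ha) hr h4 one_ne_zero ?_ hxyz
    (by linear_combination hc - x * z * hs)
  simp only [map_add, map_sub, map_smul, LinearMap.add_apply, LinearMap.sub_apply,
    LinearMap.smul_apply] at hf
  linear_combination (norm := module) -(1 / 2 : F) • hf + hp - hr

theorem tau_eq_tau_of_quarter (hB : IsAxisForm B) (ha : IsHalfAxis F a) (hb : IsHalfAxis F b)
    (h : B a b = 1 / 4) : (tau F b : A ≃ₗ[F] A) a = (tau F a : A ≃ₗ[F] A) b := by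
  rw [hB.tau_eq_add ha hb, h]
  norm_num

theorem mul_eq_of_quarter (hB : IsAxisForm B) (hb : IsHalfAxis F b)
    (h : B a b = 1 / 4) : a * b = (1 / 4 : F) • (a + b - (tau F b : A ≃ₗ[F] A) a) := by
  rw [hB.tau_apply hb, hB.comm b a, h, mul_comm b a]
  module

theorem mul_eq_zero_or_of_finite (hfin : {c : A | IsHalfAxis F c}.Finite) (hB : IsAxisForm B)
    (ha : IsHalfAxis F a) (hb : IsHalfAxis F b) (hab : a ≠ b) : a * b = 0 ∨ B a b = 1 / 4 := by
  by_cases h₀ : B a b = 0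
  · exact Or.inl (hB.mul_eq_zero_of_finite hfin ha hb h₀)
  refine Or.inr ?_
  by_contra h
  refine Set.not_infinite.2 hfin ?_
  by_cases h₂ : B a b = 1 / 2
  · exact hB.infinite_of_half ha hb h₂
  · exact hB.infinite_of_generic ha hb h₀ (fun h₁ => hab (hB.eq_of_finite hfin ha hb h₁)) h h₂

end IsAxisForm

theorem tau_eq_self_of_mul_eq_zero {a b : A} (hb : IsHalfAxis F b) (hab : a * b = 0) :
    (tau F b : A ≃ₗ[F] A) a = a := by
  have hba : b * a = 0 := by rw [mul_comm, hab]
  rw [tau_eq_tauLin hb, tauLin_of_mem (l := 0) (mem_axisEigenspace.2 (by simpa using hba))]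
  simp

theorem generates2B {a b : A} (ha : IsHalfAxis F a) (hb : IsHalfAxis F b) (hab : a * b = 0) :
    Generates2B F a b := by
  have i1 : a * a = a := ha.idem
  have i2 : b * b = b := hb.idem
  have hba : b * a = 0 := by rw [mul_comm, hab]
  obtain ⟨f, hf⟩ : ∃ f : F × F →ₙₐ[F] A, ∀ x, f x = x.1 • a + x.2 • b := ⟨
          { toFun := fun x => x.1 • a + x.2 • b
            map_smul' := fun c x => by simp [mul_smul]
            map_zero' := by simp
            map_add' := fun x y => by
              simp only [Prod.fst_add, Prod.snd_add]
              module
            map_mul' := fun x y => by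
              simp only [Prod.fst_mul, Prod.snd_mul, mul_add, add_mul, smul_mul_assoc,
                mul_smul_comm, i1, i2, hab, hba]
              module }, fun _ => rfl⟩
  have hf₀ : f (1, 0) = a := by simp [hf]
  have hf₁ : f (0, 1) = b := by simp [hf]
  refine ⟨f, ?_, ?_, hf₀, hf₁⟩
  · intro x y hxy
    rw [hf, hf] at hxy
    have h1 := congrArg (a * ·) hxy
    have h2 := congrArg (b * ·) hxy
    simp only [mul_add, mul_smul_comm, i1, i2, hab, hba, smul_zero, add_zero, zero_add] at h1 h2
    exact Prod.ext (smul_left_injective F ha.ne_zero h1) (smul_left_injective F hb.ne_zero h2)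
  · apply le_antisymm
    · rintro _ ⟨x, rfl⟩
      change f x ∈ _
      rw [hf]
      exact add_mem (SMulMemClass.smul_mem _ (NonUnitalAlgebra.subset_adjoin F (by simp)))
        (SMulMemClass.smul_mem _ (NonUnitalAlgebra.subset_adjoin F (by simp)))
    · refine NonUnitalAlgebra.adjoin_le ?_
      rintro _ (rfl | rfl)
      · exact ⟨(1, 0), hf₀⟩
      · exact ⟨(0, 1), hf₁⟩

/-- Two distinct axes span `3C(1/2)` if `B a b = 1/4`. -/
theorem IsAxisForm.generates3CHalf {B : A →ₗ[F] A →ₗ[F] F} (hB : IsAxisForm B) {a b : A}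
    (ha : IsHalfAxis F a) (hb : IsHalfAxis F b) (hab : B a b = 1 / 4) :
    Generates3CHalf F a b ((tau F b : A ≃ₗ[F] A) a) := by
  have hc : IsHalfAxis F ((tau F b : A ≃ₗ[F] A) a) := ha.tau
  have hτ := hB.tau_eq_tau_of_quarter ha hb hab
  have eab := hB.mul_eq_of_quarter hb hab
  have ecb : (tau F b : A ≃ₗ[F] A) a * b = (1 / 4 : F) • ((tau F b : A ≃ₗ[F] A) a + b - a) := by
    have := congrArg (tau F b : A ≃ₗ[F] A) eab
    simpa only [tau_mul, map_smul, map_add, map_sub, tau_self hb, tau_tau hb] using this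
  have eac : a * (tau F b : A ≃ₗ[F] A) a = (1 / 4 : F) • (a + (tau F b : A ≃ₗ[F] A) a - b) := by
    have := congrArg (tau F a : A ≃ₗ[F] A) eab
    rw [hτ] at this ⊢
    simpa only [tau_mul, map_smul, map_add, map_sub, tau_self ha, tau_tau ha] using this
  have fac : B a ((tau F b : A ≃ₗ[F] A) a) = 1 / 4 := by rw [hτ, hB.apply_tau ha, hab]
  have fbc : B b ((tau F b : A ≃ₗ[F] A) a) = 1 / 4 := by rw [hB.apply_tau hb, hB.comm, hab]
  generalize (tau F b : A ≃ₗ[F] A) a = c at *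
  have i1 : a * a = a := ha.idem
  have i2 : b * b = b := hb.idem
  have i3 : c * c = c := hc.idem
  obtain ⟨f, hf⟩ : ∃ f : ThreeC F (1 / 2) →ₙₐ[F] A, ∀ x : Fin 3 → F,
      f (show ThreeC F (1 / 2) from x) = x 0 • a + x 1 • b + x 2 • c := ⟨
          { toFun := fun x : Fin 3 → F => x 0 • a + x 1 • b + x 2 • c
            map_smul' := fun r x => by
              change (r * x 0) • a + (r * x 1) • b + (r * x 2) • c = _
              simp only [MonoidHom.id_apply]
              module
            map_zero' := by
              change (0 : F) • a + (0 : F) • b + (0 : F) • c = _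
              module
            map_add' := fun x y => by
              change (x 0 + y 0) • a + (x 1 + y 1) • b + (x 2 + y 2) • c = _
              module
            map_mul' := fun x y => by
              change ThreeC.mulFun (η := 1 / 2) x y 0 • a + ThreeC.mulFun (η := 1 / 2) x y 1 • b +
                ThreeC.mulFun (η := 1 / 2) x y 2 • c = _
              simp only [ThreeC.mulFun, mul_add, add_mul, smul_mul_assoc, mul_smul_comm, i1, i2, i3,
                mul_comm b a, mul_comm c a, mul_comm b c, eab, eac, ecb, Fin.isValue, zero_add,
                Fin.reduceAdd]
              module }, fun _ => rfl⟩
  have hf₀ : f (ThreeC.e _ 0) = a := by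
    rw [show ThreeC.e (1 / 2 : F) 0 = (Pi.single 0 1 : Fin 3 → F) from rfl, hf]
    simp
  have hf₁ : f (ThreeC.e _ 1) = b := by
    rw [show ThreeC.e (1 / 2 : F) 1 = (Pi.single 1 1 : Fin 3 → F) from rfl, hf]
    simp
  have hf₂ : f (ThreeC.e _ 2) = c := by
    rw [show ThreeC.e (1 / 2 : F) 2 = (Pi.single 2 1 : Fin 3 → F) from rfl, hf]
    simp
  refine ⟨f, ?_, ?_, hf₀, hf₁, hf₂⟩
  · intro x y hxy
    have hxy := (hf x).symm.trans (hxy.trans (hf y))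
    have h1 := congrArg (B a) hxy
    have h2 := congrArg (B b) hxy
    have h3 := congrArg (B c) hxy
    rw [hB.comm a c] at fac
    rw [hB.comm b c] at fbc
    simp only [map_add, map_smul, smul_eq_mul, hB.apply_self ha, hB.apply_self hb,
      hB.apply_self hc, hab, hB.comm b a, hB.comm a c, hB.comm b c, fac, fbc] at h1 h2 h3
    funext i
    fin_cases i
    · change x 0 = y 0
      linear_combination (10 * h1 - 2 * h2 - 2 * h3) / 9
    · change x 1 = y 1
      linear_combination (10 * h2 - 2 * h1 - 2 * h3) / 9
    · change x 2 = y 2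
      linear_combination (10 * h3 - 2 * h2 - 2 * h1) / 9
  · have hac : c ∈ NonUnitalAlgebra.adjoin F {a, b} := by
      rw [show c = a + b - (4 : F) • (a * b) by rw [eab]; module]
      have h1 : a ∈ NonUnitalAlgebra.adjoin F {a, b} :=
        NonUnitalAlgebra.subset_adjoin F (by simp)
      have h2 : b ∈ NonUnitalAlgebra.adjoin F {a, b} :=
        NonUnitalAlgebra.subset_adjoin F (by simp)
      exact sub_mem (add_mem h1 h2) (SMulMemClass.smul_mem _ (mul_mem h1 h2))
    apply le_antisymm
    · rintro _ ⟨x, rfl⟩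
      change f x ∈ _
      rw [show f x = _ from hf x]
      exact add_mem (add_mem
        (SMulMemClass.smul_mem _ (NonUnitalAlgebra.subset_adjoin F (by simp)))
        (SMulMemClass.smul_mem _ (NonUnitalAlgebra.subset_adjoin F (by simp))))
        (SMulMemClass.smul_mem _ hac)
    · refine NonUnitalAlgebra.adjoin_le ?_
      rintro _ (rfl | rfl)
      · exact ⟨ThreeC.e _ 0, hf₀⟩
      · exact ⟨ThreeC.e _ 1, hf₁⟩

end Pairs

/-! ### The 3-transposition group and its Matsuo algebra -/

section Matsuo

variable {F : Type v} [Field F] {A : Type u} [NonUnitalNonAssocCommRing A] [Module F A]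
  [IsScalarTower F A A] [SMulCommClass F A A] [CharZero F]

/-- A family of vectors indexed by `D` that multiplies like the basis of `M_{1/2}(G, D)` extends
to an algebra homomorphism. -/
theorem Matsuo.exists_hom {G : Type*} [Group G] {D : Set G} (hD : IsThreeTransposition D)
    (p : D → A) (hidem : ∀ c, p c * p c = p c)
    (h₃ : ∀ c d : D, c ≠ d → orderOf ((c : G) * d) = 3 →
      p c * p d = (1 / 4 : F) • (p c + p d - p (hD.conj c d)))
    (h₀ : ∀ c d : D, c ≠ d → orderOf ((c : G) * d) ≠ 3 → p c * p d = 0) :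
    ∃ f : Matsuo F (1 / 2) hD →ₙₐ[F] A, ∀ c, f (basis F (1 / 2) hD c) = p c := by
  set f := (basis F (1 / 2) hD).constr F p with hf
  have hfb : ∀ c, f (basis F (1 / 2) hD c) = p c := fun c => by
    rw [hf, Module.Basis.constr_basis]
  have hmul : (LinearMap.mul F (Matsuo F (1 / 2) hD)).compr₂ f =
      (LinearMap.mul F A).compl₁₂ f f := by
    refine (basis F (1 / 2) hD).ext fun c => (basis F (1 / 2) hD).ext fun d => ?_
    rw [LinearMap.compr₂_apply, LinearMap.compl₁₂_apply, LinearMap.mul_apply', LinearMap.mul_apply',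
      basis_mul_basis, hfb, hfb, basisMul]
    split_ifs with h h'
    · rw [hfb, ← h, hidem]
    · rw [h₃ c d h h', map_smul, map_sub, map_add, hfb, hfb, hfb,
        show (1 / 2 / 2 : F) = 1 / 4 by norm_num]
    · rw [h₀ c d h h', map_zero]
  exact ⟨{ f with
    map_zero' := map_zero f
    map_mul' := fun x y => LinearMap.congr_fun₂ hmul x y }, hfb⟩

/-- Let `Y` be a set of axes that is closed under its Miyamoto involutions and in which any two
axes span `2B` or `3C(1/2)`. If `d` embeds `Y` into a group as a generating set of involutions on
which conjugation is the action of the Miyamoto involutions, then the image `D` of `d` is a class of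
3-transpositions, and `d a ↦ a` extends to a homomorphism from the Matsuo algebra. -/
theorem exists_matsuo_hom {G : Type*} [Group G] {D : Set G} {Y : Set A} (d : Y → G)
    (hdD : Set.range d = D) (hgen : Subgroup.closure D = ⊤) (hinj : Function.Injective d)
    (hsq : ∀ a, d a * d a = 1) (hne : ∀ a, d a ≠ 1) (hY : ∀ a ∈ Y, IsHalfAxis F a)
    (hconj : ∀ a b : Y, ∃ h : (tau F (b : A) : A ≃ₗ[F] A) a ∈ Y, d b * d a * d b = d ⟨_, h⟩)
    (hpair : ∀ a ∈ Y, ∀ b ∈ Y, a ≠ b → a * b = 0 ∨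
      (tau F b : A ≃ₗ[F] A) a = (tau F a : A ≃ₗ[F] A) b ∧
        a * b = (1 / 4 : F) • (a + b - (tau F b : A ≃ₗ[F] A) a)) :
    ∃ hD : IsThreeTransposition D, ∃ f : Matsuo F (1 / 2) hD →ₙₐ[F] A,
      ∀ (a : Y) (h : d a ∈ D), f (Matsuo.basis F (1 / 2) hD ⟨d a, h⟩) = a := by
  subst hdD
  have hinv : ∀ a, (d a)⁻¹ = d a := fun a => inv_eq_of_mul_eq_one_left (hsq a)
  have h2 : ∀ a b : Y, (a : A) * b = 0 → (d a * d b) ^ 2 = 1 := by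
    intro a b hab
    obtain ⟨h, hc⟩ := hconj a b
    have hc : d b * d a * d b = d a := hc.trans
      (congrArg d (Subtype.ext (tau_eq_self_of_mul_eq_zero (hY b b.2) hab)))
    calc (d a * d b) ^ 2 = d a * (d b * d a * d b) := by simp only [pow_two, mul_assoc]
      _ = 1 := by rw [hc, hsq]
  have h3 : ∀ a b : Y, (tau F (b : A) : A ≃ₗ[F] A) a = (tau F (a : A) : A ≃ₗ[F] A) b →
      (d a * d b) ^ 3 = 1 := by
    intro a b hab
    obtain ⟨h, hc⟩ := hconj a b
    obtain ⟨h', hc'⟩ := hconj b a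
    have hc : d b * d a * d b = d a * d b * d a :=
      (hc.trans (congrArg d (Subtype.ext hab))).trans hc'.symm
    calc (d a * d b) ^ 3 = d a * (d b * d a * d b) * (d a * d b) := by
          simp only [pow_three, mul_assoc]
      _ = d a * d a * d b * (d a * d a) * d b := by rw [hc]; simp only [mul_assoc]
      _ = 1 := by rw [hsq, one_mul, mul_one, hsq]
  have hpow : ∀ a b : Y, ∃ n, 0 < n ∧ n ≤ 3 ∧ (d a * d b) ^ n = 1 := by
    intro a b
    by_cases hab : a = b
    · exact ⟨1, by norm_num, by norm_num, by rw [hab, hsq, one_pow]⟩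
    rcases hpair a a.2 b b.2 (fun h => hab (Subtype.ext h)) with h | h
    · exact ⟨2, by norm_num, by norm_num, h2 a b h⟩
    · exact ⟨3, by norm_num, by norm_num, h3 a b h.1⟩
  have hmem : ∀ g x : G, g⁻¹ * x * g ∈ Set.range d ↔ x ∈ Set.range d := by
    intro g
    have hg : g ∈ Subgroup.closure (Set.range d) := by rw [hgen]; trivial
    have key : ∀ (b : Y) (x : G), x ∈ Set.range d → d b * x * d b ∈ Set.range d := by
      rintro b _ ⟨a, rfl⟩
      obtain ⟨h, hc⟩ := hconj a b
      exact ⟨_, hc.symm⟩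
    induction hg using Subgroup.closure_induction with
    | mem g hg =>
      obtain ⟨b, rfl⟩ := hg
      intro x
      rw [hinv]
      refine ⟨fun h => ?_, key b x⟩
      have h1 := key b _ h
      have h4 : d b * (d b * x * d b) * d b = (d b * d b) * x * (d b * d b) := by group
      rwa [h4, hsq, one_mul, mul_one] at h1
    | one => simp
    | mul g k _ _ hg hk =>
      intro x
      rw [← hg x, ← hk (g⁻¹ * x * g)]
      simp only [mul_inv_rev, mul_assoc]
    | inv g _ hg =>
      intro x
      rw [← hg]
      group
  have hD : IsThreeTransposition (Set.range d) :=
    { closure_eq_top := hgen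
      conj_mem := fun x hx g => (hmem g x).2 hx
      orderOf_eq_two := by
        rintro _ ⟨a, rfl⟩
        exact orderOf_eq_prime (by rw [pow_two, hsq]) (hne a)
      orderOf_mul_pos := by
        rintro _ ⟨a, rfl⟩ _ ⟨b, rfl⟩
        obtain ⟨n, h0, -, h⟩ := hpow a b
        exact orderOf_pos_iff.2 (isOfFinOrder_iff_pow_eq_one.2 ⟨n, h0, h⟩)
      orderOf_mul_le := by
        rintro _ ⟨a, rfl⟩ _ ⟨b, rfl⟩
        obtain ⟨n, h0, h4, h⟩ := hpow a b
        exact (orderOf_le_of_pow_eq_one h0 h).trans h4 }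
  choose p hp using fun c : Set.range d => c.2
  have hpd : ∀ (a : Y) (h : d a ∈ Set.range d), p ⟨d a, h⟩ = a := fun a h =>
    hinj (hp ⟨d a, h⟩)
  have hpne : ∀ c e : Set.range d, c ≠ e → (p c : A) ≠ p e := fun c e hce h => hce
    (Subtype.ext (by rw [← hp c, ← hp e, Subtype.ext h]))
  obtain ⟨f, hf⟩ := Matsuo.exists_hom (F := F) hD (fun c => (p c : A))
    (fun c => (hY _ (p c).2).idem)
    (by
      intro c e hce h
      rcases hpair _ (p c).2 _ (p e).2 (hpne c e hce) with h0 | ⟨-, h1⟩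
      · have h4 := orderOf_dvd_of_pow_eq_one (h2 _ _ h0)
        rw [hp, hp, h] at h4
        norm_num at h4
      · obtain ⟨hm, hc⟩ := hconj (p c) (p e)
        have h5 : p (hD.conj c e) = ⟨_, hm⟩ := hinj <| by
          rw [hp, ← hc, hp, hp]
          change (e : G)⁻¹ * c * e = _
          rw [← hp e, hinv]
        rw [h1, h5])
    (by
      intro c e hce h
      rcases hpair _ (p c).2 _ (p e).2 (hpne c e hce) with h0 | ⟨h1, -⟩
      · exact h0
      · have h4 := orderOf_eq_prime (h3 _ _ h1) (fun h5 => hpne c e hce ?_)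
        · rw [hp, hp] at h4
          exact absurd h4 h
        · exact congrArg _ (hinj ((mul_eq_one_iff_eq_inv.1 h5).trans (hinv _))))
  exact ⟨hD, f, fun a h => by rw [hf, hpd]⟩

end Matsuo

section Main

variable {F : Type v} [Field F] {A : Type u} [NonUnitalNonAssocCommRing A] [Module F A]
  [IsScalarTower F A A] [SMulCommClass F A A] [CharZero F]

theorem tau_tau_eq_conj {a b : A} (ha : IsHalfAxis F a) (hb : IsHalfAxis F b) :
    tau F ((tau F b : A ≃ₗ[F] A) a) = tau F b * tau F a * tau F b := by
  rw [tau_map ha, tau_inv hb]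

variable (F A) in
/-- Any two distinct axes span `2B` or `3C(1/2)`, as expressed by their product and by their
Miyamoto involutions. -/
def AxisPairs : Prop :=
  ∀ a b : A, IsHalfAxis F a → IsHalfAxis F b → a ≠ b → a * b = 0 ∨
    (tau F b : A ≃ₗ[F] A) a = (tau F a : A ≃ₗ[F] A) b ∧
      a * b = (1 / 4 : F) • (a + b - (tau F b : A ≃ₗ[F] A) a)

namespace AxisPairs

variable (hP : AxisPairs F A)
include hP

theorem tau_eq_self {a b : A} (ha : IsHalfAxis F a) (hb : IsHalfAxis F b)
    (h : tau F a = 1) : (tau F b : A ≃ₗ[F] A) a = a := by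
  by_cases hab : a = b
  · rw [hab, tau_self hb]
  rcases hP a b ha hb hab with h0 | ⟨h1, -⟩
  · exact tau_eq_self_of_mul_eq_zero hb h0
  · have h2 : (tau F b : A ≃ₗ[F] A) a = b := by rw [h1, h]; rfl
    exact absurd ((tau F b : A ≃ₗ[F] A).injective (h2.trans (tau_self hb).symm)) hab

/-- An axis with nontrivial Miyamoto involution is determined by it: if `τ_a = τ_b` moves an
axis `x`, then `τ_x` maps both `a` and `b` to the image of `x`. -/
theorem eq_of_tau_eq (hS : Submodule.span F {a : A | IsHalfAxis F a} = ⊤) {a b : A}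
    (ha : IsHalfAxis F a) (hb : IsHalfAxis F b) (hab : tau F a = tau F b) (h1 : tau F a ≠ 1) :
    a = b := by
  obtain ⟨x, hx, hxa⟩ : ∃ x, IsHalfAxis F x ∧ (tau F a : A ≃ₗ[F] A) x ≠ x := by
    by_contra! h
    refine h1 (Subtype.ext (LinearEquiv.toLinearMap_injective (LinearMap.ext_on hS ?_)))
    exact fun x hx => h x hx
  have key : ∀ c, IsHalfAxis F c → (tau F c : A ≃ₗ[F] A) x ≠ x →
      (tau F c : A ≃ₗ[F] A) x = (tau F x : A ≃ₗ[F] A) c := by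
    intro c hc hcx
    have hne : x ≠ c := by
      rintro rfl
      exact hcx (tau_self hc)
    rcases hP x c hx hc hne with h0 | ⟨h, -⟩
    · exact absurd (tau_eq_self_of_mul_eq_zero hc h0) hcx
    · exact h
  refine (tau F x : A ≃ₗ[F] A).injective ?_
  rw [← key a ha hxa, ← key b hb (by rwa [← hab]), hab]

end AxisPairs

theorem matsuoHom_surjective {X : Set A} (hX : IsJordanTypeHalf F X) {G : Type*} [Group G]
    {D : Set G} {hD : IsThreeTransposition D} (f : Matsuo F (1 / 2) hD →ₙₐ[F] A)
    (h : ∀ a ∈ X, ∃ x, f x = a) : Function.Surjective f := by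
  intro y
  have : NonUnitalAlgebra.adjoin F X ≤ NonUnitalAlgHom.range f :=
    NonUnitalAlgebra.adjoin_le fun a ha => h a ha
  rw [hX.generates] at this
  exact this trivial

open Classical in
variable (F) in
/-- The Miyamoto involution `τ_a`, made nontrivial and faithful in `a` for the axes with `τ_a = 1`
by a central involution of its own. -/
noncomputable def extendedTau (a : A) : AlgAut F A × (A → ℤˣ) :=
  (tau F a, if tau F a = 1 then Pi.mulSingle a (-1) else 1)

open Classical in
theorem AxisPairs.isMatsuoOrFactor (hP : AxisPairs F A) {X : Set A} (hX : IsJordanTypeHalf F X) :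
    IsMatsuoOrFactor F A := by
  have hne : ∀ a : A, (Pi.mulSingle a (-1) : A → ℤˣ) ≠ 1 := fun a h => by
    have := congrFun h a
    simp at this
  set Y : Set A := {a | IsHalfAxis F a}
  have hY : ∀ a : Y, IsHalfAxis F (a : A) := fun a => a.2
  set d₀ : Y → AlgAut F A × (A → ℤˣ) := fun a => extendedTau F (a : A) with hd₀
  have hmem : ∀ a, d₀ a ∈ Subgroup.closure (Set.range d₀) := fun a =>
    Subgroup.subset_closure ⟨a, rfl⟩
  set d : Y → Subgroup.closure (Set.range d₀) := fun a => ⟨d₀ a, hmem a⟩ with hd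
  have h2 : ∀ g : A → ℤˣ, g * g = 1 := fun g => funext fun x => Int.units_mul_self (g x)
  obtain ⟨hD, f, hf⟩ := exists_matsuo_hom (F := F) (D := Set.range d) d rfl
    (by
      rw [← Subgroup.closure_closure_coe_preimage]
      congr 1
      ext g
      constructor
      · rintro ⟨a, rfl⟩
        exact ⟨a, rfl⟩
      · rintro ⟨a, ha⟩
        exact ⟨a, Subtype.ext ha⟩)
    (by
      intro a b hab
      have h := congrArg Subtype.val hab
      have h3 : tau F (a : A) = tau F (b : A) := congrArg Prod.fst h
      have h4 := congrArg Prod.snd h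
      by_cases h1 : tau F (a : A) = 1
      · simp only [hd, hd₀, extendedTau, ← h3, if_pos h1] at h4
        have h5 := congrFun h4 a
        by_contra hne
        rw [Pi.mulSingle_eq_same, Pi.mulSingle_eq_of_ne (fun h => hne (Subtype.ext h))] at h5
        simp at h5
      · exact Subtype.ext (hP.eq_of_tau_eq hX.span_axes (hY a) (hY b) h3 h1))
    (fun a => Subtype.ext (Prod.ext (tau_mul_self (hY a)) (h2 _)))
    (fun a h => by
      have h := congrArg Subtype.val h
      have h3 : tau F (a : A) = 1 := congrArg Prod.fst h
      have h4 := congrArg Prod.snd h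
      simp only [hd, hd₀, extendedTau, if_pos h3] at h4
      exact hne _ h4)
    (fun a ha => ha)
    (fun a b => ⟨(hY a).tau, Subtype.ext (Prod.ext (tau_tau_eq_conj (hY a) (hY b)).symm (by
      have h3 : ∀ g k : A → ℤˣ, k * g * k = g := fun g k => by
        rw [mul_comm k g, mul_assoc, h2, mul_one]
      refine (h3 _ _).trans ?_
      change (extendedTau F (a : A)).2 = (extendedTau F ((tau F (b : A) : A ≃ₗ[F] A) (a : A))).2
      by_cases h1 : tau F (a : A) = 1
      · rw [hP.tau_eq_self (hY a) (hY b) h1]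
      · have h4 : tau F ((tau F (b : A) : A ≃ₗ[F] A) (a : A)) ≠ 1 := by
          rw [tau_map (hY a), Ne, conj_eq_one_iff]
          exact h1
        simp only [extendedTau, if_neg h1, if_neg h4]))⟩)
    (fun a ha b hb hab => hP a b ha hb hab)
  exact ⟨_, inferInstance, _, hD, f, matsuoHom_surjective hX f fun a ha =>
    ⟨_, hf ⟨a, hX.primitive a ha⟩ ⟨_, rfl⟩⟩⟩

section Closure

variable {X : Set A} (hX : IsJordanTypeHalf F X)
include hX

theorem IsJordanTypeHalf.subset_axisClosure : X ⊆ axisClosure F X :=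
  fun a ha => ⟨a, ha, 1, one_mem _, rfl⟩

theorem IsJordanTypeHalf.isHalfAxis_of_mem {a : A} (ha : a ∈ axisClosure F X) :
    IsHalfAxis F a := by
  obtain ⟨x, hx, φ, -, rfl⟩ := ha
  exact (hX.primitive x hx).map φ

theorem IsJordanTypeHalf.tau_mem {a : A} (ha : a ∈ axisClosure F X) :
    tau F a ∈ miyamotoGroup F X := by
  obtain ⟨x, hx, φ, hφ, rfl⟩ := ha
  rw [tau_map (hX.primitive x hx)]
  exact mul_mem (mul_mem hφ (Subgroup.subset_closure ⟨x, hx, rfl⟩)) (inv_mem hφ)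

theorem IsJordanTypeHalf.tau_apply_mem {a b : A} (ha : a ∈ axisClosure F X)
    (hb : b ∈ axisClosure F X) : (tau F b : A ≃ₗ[F] A) a ∈ axisClosure F X := by
  have := hX.tau_mem hb
  obtain ⟨x, hx, φ, hφ, rfl⟩ := ha
  exact ⟨x, hx, _, mul_mem this hφ, rfl⟩

theorem AxisPairs.exists_miyamoto_hom (hP : AxisPairs F A) :
    ∃ hD : IsThreeTransposition (miyamotoInvolutions F X),
      ∃ f : Matsuo F (1 / 2) hD →ₙₐ[F] A,
        (∀ (g : miyamotoInvolutions F X) (a : A), a ∈ axisClosure F X →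
          tau F a = ((g : miyamotoGroup F X) : AlgAut F A) →
          f (Matsuo.basis F (1 / 2) hD g) = a) ∧
        ((∀ a ∈ X, tau F a ≠ 1) → Function.Surjective f) := by
  set Y : Set A := {a | a ∈ axisClosure F X ∧ tau F a ≠ 1}
  have hY : ∀ a : Y, IsHalfAxis F (a : A) := fun a => hX.isHalfAxis_of_mem a.2.1
  set d : Y → miyamotoGroup F X := fun a => ⟨tau F (a : A), hX.tau_mem a.2.1⟩ with hd
  have hdD : Set.range d = miyamotoInvolutions F X := by
    ext g
    constructor
    · rintro ⟨a, rfl⟩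
      exact ⟨fun h => a.2.2 (congrArg Subtype.val h), a, a.2.1, rfl⟩
    · rintro ⟨hg, a, ha, hag⟩
      exact ⟨⟨a, ha, fun h => hg (Subtype.ext (hag.symm.trans h))⟩, Subtype.ext hag⟩
  obtain ⟨hD, f, hf⟩ := exists_matsuo_hom (F := F) d hdD
    (by
      refine eq_top_iff.2 ((Subgroup.closure_closure_coe_preimage (k := tau F '' X)).ge.trans
        ((Subgroup.closure_le _).2 ?_))
      rintro g ⟨a, ha, hag⟩
      by_cases hg : g = 1
      · rw [hg]
        exact one_mem _
      · exact Subgroup.subset_closure ⟨hg, a, hX.subset_axisClosure ha, hag⟩)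
    (fun a b hab => Subtype.ext (hP.eq_of_tau_eq hX.span_axes (hY a) (hY b)
      (congrArg Subtype.val hab) a.2.2))
    (fun a => Subtype.ext (tau_mul_self (hY a)))
    (fun a h => a.2.2 (congrArg Subtype.val h))
    (fun a ha => hX.isHalfAxis_of_mem ha.1)
    (fun a b => ⟨⟨hX.tau_apply_mem a.2.1 b.2.1, by
      rw [tau_map (hY a), Ne, conj_eq_one_iff]
      exact a.2.2⟩, Subtype.ext (tau_tau_eq_conj (hY a) (hY b)).symm⟩)
    (fun a ha b hb hab => hP a b (hX.isHalfAxis_of_mem ha.1) (hX.isHalfAxis_of_mem hb.1) hab)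
  have hf' : ∀ (g : miyamotoInvolutions F X) (a : A), a ∈ axisClosure F X →
      tau F a = ((g : miyamotoGroup F X) : AlgAut F A) → f (Matsuo.basis F (1 / 2) hD g) = a := by
    rintro ⟨g, hg⟩ a ha hag
    have ha1 : tau F a ≠ 1 := fun h => hg.1 (Subtype.ext (hag.symm.trans h))
    obtain rfl : d ⟨a, ha, ha1⟩ = g := Subtype.ext hag
    exact hf ⟨a, ha, ha1⟩ hg
  refine ⟨hD, f, hf', fun hne => matsuoHom_surjective hX f fun a ha => ?_⟩
  have ha' := hX.subset_axisClosure ha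
  exact ⟨_, hf ⟨a, ha', hne a ha⟩ (hdD ▸ ⟨_, rfl⟩)⟩

end Closure

theorem IsAxisForm.axisPairs_of_finite {B : A →ₗ[F] A →ₗ[F] F} (hB : IsAxisForm B)
    (hfin : {c : A | IsHalfAxis F c}.Finite) : AxisPairs F A := by
  intro a b ha hb hab
  exact (hB.mul_eq_zero_or_of_finite hfin ha hb hab).imp_right fun h =>
    ⟨hB.tau_eq_tau_of_quarter ha hb h, hB.mul_eq_of_quarter hb h⟩

end Main

theorem theorem3 {F : Type v} [Field F] [CharZero F] {A : Type u} [NonUnitalNonAssocCommRing A]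
    [Module F A] [IsScalarTower F A A] [SMulCommClass F A A]
    (X : Set A) (hX : IsJordanTypeHalf F X) :
    ({a : A | IsPrimitiveAxis (jordanLaw (1 / 2 : F)) a}.Infinite ∨ IsMatsuoOrFactor F A) ∧
    ({a : A | IsPrimitiveAxis (jordanLaw (1 / 2 : F)) a}.Finite →
      -- every two distinct primitive axes generate a `2B` or a `3C(1/2)`
      (∀ a b : A, IsPrimitiveAxis (jordanLaw (1 / 2 : F)) a →
        IsPrimitiveAxis (jordanLaw (1 / 2 : F)) b → a ≠ b →
        Generates2B F a b ∨
          ∃ c : A, (tau F b : A ≃ₗ[F] A) a = c ∧ (tau F a : A ≃ₗ[F] A) b = c ∧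
            Generates3CHalf F a b c) ∧
      -- the Miyamoto group is a 3-transposition group, and its Matsuo algebra maps to `A`
      (∃ hD : IsThreeTransposition (miyamotoInvolutions F X),
        ∃ f : Matsuo F (1 / 2) hD →ₙₐ[F] A,
          (∀ (g : miyamotoInvolutions F X) (a : A), a ∈ axisClosure F X →
            tau F a = ((g : miyamotoGroup F X) : AlgAut F A) →
            f (Matsuo.basis F (1 / 2) hD g) = a) ∧
          -- the homomorphism is onto if no Miyamoto involution of a generating axis is trivial
          ((∀ a ∈ X, tau F a ≠ 1) → Function.Surjective f))) := by
  obtain ⟨B, hB⟩ := exists_isAxisForm hX.span_axes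
  refine ⟨?_, fun hfin => ⟨fun a b ha hb hab => ?_,
    AxisPairs.exists_miyamoto_hom hX (hB.axisPairs_of_finite hfin)⟩⟩
  · refine (Set.finite_or_infinite _).symm.imp_right fun hfin => ?_
    exact (hB.axisPairs_of_finite hfin).isMatsuoOrFactor hX
  · refine (hB.mul_eq_zero_or_of_finite hfin ha hb hab).imp (generates2B ha hb) fun h => ?_
    exact ⟨_, rfl, (hB.tau_eq_tau_of_quarter ha hb h).symm, hB.generates3CHalf ha hb h⟩
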